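/- Let $H$ be an infinite-dimensional separable real Hilbert space, $\Psi:H\to H$ a bounded linear operator, and let $\{X_n\}_{n\ge1}$ be an $H$-valued ARH(1) process, $X_{n+1}=\Psi(X_n)+\varepsilon_{n+1}$ for $n\ge 1$, with Hilbert–Schmidt norm $\|\Psi\|_{\mathcal S}=\big(\sum_k\|\Psi(e_k)\|^2\big)^{1/2}<1$ ($\{e_k\}$ any orthonormal basis). Write $(x\otimes y)(z)=\langle x,z\rangle y$. A sequence $\{Z_n\}_{n\ge1}$ of random elements with $E\|Z_n\|^4<\infty$ is called $L^4$–$m$–approximable if $Z_n=f(\delta_n,\delta_{n-1},\dots)$ with i.i.d. $\delta_i$, $i\in\mathbb Z$, in a measurable space $S$ and a measurable $f:S^\infty\to H$, such that $\sum_{m\ge1}\big(E\|Z_m-Z_m^{(m)}\|^4\big)^{1/4}<\infty$, where $Z_n^{(m)}=f(\delta_n,\dots,\delta_{n-m+1},\delta'_{n-m},\delta'_{n-m-1},\dots)$ and $\{\delta_i'\}$ is an independent copy of $\{\delta_i\}$ (on an enlarged probability space, if necessary). $H$-white noise is a sequence of square integrable, pairwise orthogonal ($E[Z_i\otimes Z_j]=0$,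 $i\ne j$) random elements with constant mean and constant covariance operator. Assume (A), where the errors of the regression of $X_{k+1}$ on $X_k$ are $\varepsilon_{k+1}$: the sequences $\{X_k\}_{k\ge1}$ and $\{\varepsilon_{k+1}\}_{k\ge1}$ have zero mean and are $L^4$–$m$–approximable, $\{\varepsilon_{k+1}\}_{k\ge 1}$ is $H$-white noise, and $E[X_k\otimes\varepsilon_{k+1}]=0$ for all $k\ge1$. Assume that the covariance operator $C=E[X_1\otimes X_1]$ has full rank ($\overline{\mathrm{Im}(C)}=H$), and that its eigenvalues $\lambda_1\ge\lambda_2\ge\dots$, listed with multiplicity, are mutually distinct. Let $\hat C_n=\frac1n\sum_{k=1}^nX_k\otimes X_k$ and $\hat\Delta_n=\frac1n\sum_{k=1}^nX_k\otimes X_{k+1}$, let $\hat\lambda_1\ge\hat\lambda_2\ge\dots$ be the eigenvalues of $\hat C_n$ with multiplicity and $\hat v_1,\hat v_2,\dots$ corresponding orthonormal eigenvectors (any choice), and put $\hat\alpha_1=\hat\lambda_1-\hat\lambda_2$, $\hat\alpha_j=\min\{\hat\lambda_{j-1}-\hat\lambda_j,\hat\lambda_j-\hat\lambda_{j+1}\}$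 for $j>1$. Let (K) hold: $m_n$ are real numbers with $m_n\to\infty$ and $m_n^6=o(n)$, and $K_n=\min(B_n,E_n,\lfloor m_n\rfloor)$ with $B_n=\max\{j\ge1:\hat\lambda_j^{-1}\le m_n\}$, $E_n=\max\{k\ge1:\max_{1\le j\le k}\hat\alpha_j^{-1}\le m_n\}$, where $0^{-1}=\infty$ and the maximum of the empty set is $0$. Then the estimator $$\hat\Psi_{K_n}(x)=\sum_{j=1}^{K_n}\frac{\hat\Delta_n(\hat v_j)}{\hat\lambda_j}\langle\hat v_j,x\rangle$$ is weakly consistent for $\Psi$ in operator norm: $\|\hat\Psi_{K_n}-\Psi\|_{\mathcal L(H)}\to0$ in probability as $n\to\infty$. -/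

import Mathlib

open MeasureTheory ProbabilityTheory Filter Topology
open scoped ENNReal

universe u v w w₁ w₂

namespace HilbertRegression

noncomputable section

section Operators

variable {H₁ : Type u} [NormedAddCommGroup H₁] [InnerProductSpace ℝ H₁]
variable {H₂ : Type v} [NormedAddCommGroup H₂] [InnerProductSpace ℝ H₂]

/-- The operator `x ⊗ y : H₁ → H₂`, `(x ⊗ y)(z) = ⟨x, z⟩ y`. -/
def tensor (x : H₁) (y : H₂) : H₁ →L[ℝ] H₂ :=
  InnerProductSpace.rankOne ℝ y x

theorem tensor_apply (x z : H₁) (y : H₂) : tensor x y z = (inner ℝ x z : ℝ) • y := rfl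

/-- The Hilbert-Schmidt norm `(∑ ‖Φ eᵢ‖²)^{1/2}` (possibly `∞`) with respect to some orthonormal
basis of `H₁`; by `hilbertSchmidtNorm_eq` below the basis does not matter. -/
def hilbertSchmidtNorm [CompleteSpace H₁] (Φ : H₁ →L[ℝ] H₂) : ℝ≥0∞ :=
  (∑' i, ‖Φ ((exists_hilbertBasis ℝ H₁).choose_spec.choose i)‖ₑ ^ 2) ^ (1 / 2 : ℝ)

theorem enorm_sq_eq_tsum {ι : Type*} (b : HilbertBasis ι ℝ H₁) (x : H₁) :
    ‖x‖ₑ ^ 2 = ∑' i, ‖(inner ℝ (b i) x : ℝ)‖ₑ ^ 2 := by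
  have h := b.hasSum_inner_mul_inner x x
  have h2 : ∀ i, (inner ℝ x (b i) : ℝ) * inner ℝ (b i) x = (inner ℝ (b i) x : ℝ) ^ 2 := by
    intro i
    rw [real_inner_comm]
    ring
  simp only [h2] at h
  rw [real_inner_self_eq_norm_sq] at h
  have h3 : ∀ i, ‖(inner ℝ (b i) x : ℝ)‖ₑ ^ 2 = ENNReal.ofReal ((inner ℝ (b i) x : ℝ) ^ 2) := by
    intro i
    rw [← ofReal_norm, ← ENNReal.ofReal_pow (norm_nonneg _), Real.norm_eq_abs, sq_abs]
  simp only [h3]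
  rw [← ENNReal.ofReal_tsum_of_nonneg (fun i => sq_nonneg _) h.summable, h.tsum_eq,
    ENNReal.ofReal_pow (norm_nonneg _), ofReal_norm]

theorem tsum_enorm_sq_eq_adjoint [CompleteSpace H₁] [CompleteSpace H₂] {ι κ : Type*}
    (b : HilbertBasis ι ℝ H₁) (c : HilbertBasis κ ℝ H₂) (Φ : H₁ →L[ℝ] H₂) :
    ∑' i, ‖Φ (b i)‖ₑ ^ 2 = ∑' j, ‖ContinuousLinearMap.adjoint Φ (c j)‖ₑ ^ 2 := by
  simp only [enorm_sq_eq_tsum c, enorm_sq_eq_tsum b]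
  rw [ENNReal.tsum_comm]
  refine tsum_congr fun j => tsum_congr fun i => ?_
  rw [ContinuousLinearMap.adjoint_inner_right, real_inner_comm]

theorem hilbertSchmidtNorm_eq [CompleteSpace H₁] [CompleteSpace H₂] {ι : Type*}
    (b : HilbertBasis ι ℝ H₁) (Φ : H₁ →L[ℝ] H₂) :
    hilbertSchmidtNorm Φ = (∑' i, ‖Φ (b i)‖ₑ ^ 2) ^ (1 / 2 : ℝ) := by
  have c := (exists_hilbertBasis ℝ H₂).choose_spec.choose
  rw [hilbertSchmidtNorm, tsum_enorm_sq_eq_adjoint _ c, tsum_enorm_sq_eq_adjoint b c]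

/-- `lam` and `v` list the eigenvalues (in decreasing order, according to multiplicity) and
orthonormal eigenvectors of a positive compact operator `T`: those eigenvectors that belong to a
non-zero eigenvalue form an orthonormal basis of the closure of the image of `T`.
The indexing starts at `0`: `lam j` is the `(j+1)`-st largest eigenvalue. -/
structure IsEigensystem (T : H₁ →L[ℝ] H₁) (lam : ℕ → ℝ) (v : ℕ → H₁) : Prop where
  antitone : Antitone lam
  orthonormal : Orthonormal ℝ v
  apply_eq : ∀ j, T (v j) = lam j • v j
  closure_span : (Submodule.span ℝ {x | ∃ j, lam j ≠ 0 ∧ x = v j}).topologicalClosure =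
    (LinearMap.range (T : H₁ →ₗ[ℝ] H₁)).topologicalClosure

end Operators

section Selection

/-- The spectral gaps: `α₁ = λ₁ - λ₂` and `αⱼ = min {λⱼ₋₁ - λⱼ, λⱼ - λⱼ₊₁}` for `j > 1`
(indexing from `0`, so that `spectralGap lam j` is the `(j+1)`-st gap). -/
def spectralGap (lam : ℕ → ℝ) : ℕ → ℝ
  | 0 => lam 0 - lam 1
  | j + 1 => min (lam j - lam (j + 1)) (lam (j + 1) - lam (j + 2))

/-- `B = max {j ≥ 1 | λⱼ⁻¹ ≤ m}`, where `0⁻¹ = ∞`; it is `0` if there is no such `j`. -/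
def indexB (lam : ℕ → ℝ) (m : ℝ) : ℕ :=
  sSup {k : ℕ | ∃ j, k = j + 1 ∧ 0 < lam j ∧ (lam j)⁻¹ ≤ m}

/-- `E = max {k ≥ 1 | max_{1 ≤ j ≤ k} αⱼ⁻¹ ≤ m}`, where `0⁻¹ = ∞`; it is `0` if there is no such
`k`. -/
def indexE (lam : ℕ → ℝ) (m : ℝ) : ℕ :=
  sSup {k : ℕ | 1 ≤ k ∧ ∀ j < k, 0 < spectralGap lam j ∧ (spectralGap lam j)⁻¹ ≤ m}

/-- The truncation level `K = min (B, E, m)`, as an integer. -/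
def truncationLevel (lam : ℕ → ℝ) (m : ℝ) : ℕ :=
  min (min (indexB lam m) (indexE lam m)) ⌊m⌋₊

end Selection

section Probability

variable {Ω : Type u} [MeasurableSpace Ω]

/-- Given `X_n = f (δ_n, δ_{n-1}, …)`, the random variable
`X_n^{(m)} = f (δ_n, …, δ_{n-m+1}, δ'_{n-m}, δ'_{n-m-1}, …)`. It lives on `Ω × Ω`, where
`δ i` is evaluated at the first coordinate and its copy `δ' i` is `δ i` evaluated at the second
coordinate, so that under `P.prod P` the `δ'` are independent copies of the `δ`. -/
def coupled {S : Type w} {H : Type v} (f : (ℕ → S) → H) (δ : ℤ → Ω → S) (n m : ℕ)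
    (z : Ω × Ω) : H :=
  f fun k => if k < m then δ ((n : ℤ) - k) z.1 else δ ((n : ℤ) - k) z.2

variable {H : Type v} [NormedAddCommGroup H] [InnerProductSpace ℝ H]
  [MeasurableSpace H]

/-- `L^p`-`m`-approximability of a sequence `(X_n)_{n ≥ 1}` in `L^p` (the value `X 0` is not
used). -/
def LpMApproximable (p : ℝ≥0∞) (X : ℕ → Ω → H) (P : Measure Ω) : Prop :=
  (∀ n, 1 ≤ n → MemLp (X n) p P) ∧
  ∃ (S : Type w) (_ : MeasurableSpace S) (δ : ℤ → Ω → S) (f : (ℕ → S) → H),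
    (∀ i, Measurable (δ i)) ∧ iIndepFun δ P ∧ (∀ i, IdentDistrib (δ i) (δ 0) P P) ∧
    Measurable f ∧
    (∀ n : ℕ, 1 ≤ n → X n =ᵐ[P] fun ω => f fun k : ℕ => δ ((n : ℤ) - k) ω) ∧
    ∑' m : ℕ, eLpNorm (fun z : Ω × Ω => X (m + 1) z.1 - coupled f δ (m + 1) (m + 1) z) p
      (P.prod P) < ∞

/-- The covariance operator `E[(X - μ) ⊗ (X - μ)]`, `μ = E X`. -/
def covOperator (X : Ω → H) (P : Measure Ω) : H →L[ℝ] H :=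
  ∫ ω, tensor (X ω - ∫ ω', X ω' ∂P) (X ω - ∫ ω', X ω' ∂P) ∂P

/-- Orthogonality `X ⊥ Y`, i.e. `E[X ⊗ Y] = 0`. -/
def Orthogonal {H₁ : Type v} [NormedAddCommGroup H₁] [InnerProductSpace ℝ H₁]
    {H₂ : Type w} [NormedAddCommGroup H₂] [InnerProductSpace ℝ H₂]
    (X : Ω → H₁) (Y : Ω → H₂) (P : Measure Ω) : Prop :=
  ∫ ω, tensor (X ω) (Y ω) ∂P = 0

/-- `(e_k)_{k ≥ 1}` is `H`-white noise: square integrable and pairwise orthogonal, with constant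
mean and constant covariance operator. -/
structure IsWhiteNoise (e : ℕ → Ω → H) (P : Measure Ω) : Prop where
  memLp : ∀ k, 1 ≤ k → MemLp (e k) 2 P
  mean_eq : ∀ k, 1 ≤ k → ∫ ω, e k ω ∂P = ∫ ω, e 1 ω ∂P
  cov_eq : ∀ k, 1 ≤ k → covOperator (e k) P = covOperator (e 1) P
  orthogonal : ∀ i j, 1 ≤ i → 1 ≤ j → i ≠ j → Orthogonal (e i) (e j) P

/-- Assumption (A) on the regressors `(X_k)_{k ≥ 1}` in `H₁` and the errors `(e_k)_{k ≥ 1}` in `H₂`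
of the linear model `Y_k = Ψ X_k + e_k`. -/
structure AssumptionA {H₁ : Type v} [NormedAddCommGroup H₁] [InnerProductSpace ℝ H₁]
    [MeasurableSpace H₁] {H₂ : Type w} [NormedAddCommGroup H₂] [InnerProductSpace ℝ H₂]
    [MeasurableSpace H₂] (X : ℕ → Ω → H₁) (e : ℕ → Ω → H₂) (P : Measure Ω) : Prop where
  mean_X : ∀ k, 1 ≤ k → ∫ ω, X k ω ∂P = 0
  mean_e : ∀ k, 1 ≤ k → ∫ ω, e k ω ∂P = 0
  approximable_X : LpMApproximable.{u, v, w₁} 4 X P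
  approximable_e : LpMApproximable.{u, w, w₂} 4 e P
  whiteNoise : IsWhiteNoise e P
  orthogonal : ∀ k, 1 ≤ k → Orthogonal (X k) (e k) P

/-- `(X_n)_{n ≥ 1}` solves the ARH(1) recursion `X_{n+1} = Ψ X_n + ε_{n+1}`, `n ≥ 1`, almost
surely. -/
def IsARH1 (Ψ : H →L[ℝ] H) (X ε : ℕ → Ω → H) (P : Measure Ω) : Prop :=
  ∀ n, 1 ≤ n → ∀ᵐ ω ∂P, X (n + 1) ω = Ψ (X n ω) + ε (n + 1) ω

end Probability

section Estimator

variable {Ω : Type w} {H₁ : Type u} [NormedAddCommGroup H₁] [InnerProductSpace ℝ H₁]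
variable {H₂ : Type v} [NormedAddCommGroup H₂] [InnerProductSpace ℝ H₂]

/-- `n⁻¹ ∑_{k=1}^n X_k ⊗ Y_k`. With `Y = X` this is the empirical covariance operator. -/
def empiricalCross (X : ℕ → Ω → H₁) (Y : ℕ → Ω → H₂) (n : ℕ) (ω : Ω) : H₁ →L[ℝ] H₂ :=
  (n : ℝ)⁻¹ • ∑ k ∈ Finset.Icc 1 n, tensor (X k ω) (Y k ω)

/-- The principal components estimator `x ↦ ∑_{j=1}^K λⱼ⁻¹ ⟨vⱼ, x⟩ Δ(vⱼ)`, built from eigenvalues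
`lam`, eigenvectors `v` and a cross covariance operator `D`. -/
def pcEstimator (D : H₁ →L[ℝ] H₂) (lam : ℕ → ℝ) (v : ℕ → H₁) (K : ℕ) : H₁ →L[ℝ] H₂ :=
  ∑ j ∈ Finset.range K, tensor (v j) ((lam j)⁻¹ • D (v j))

end Estimator

end

end HilbertRegression

open HilbertRegression

namespace HilbertRegression

/-! ### Hilbert–Schmidt bounds for the operator norm. -/

section HilbertSchmidt

variable {H : Type v} [NormedAddCommGroup H] [InnerProductSpace ℝ H]

/-! Put `R_k = X_{k+1} - Ψ X_k`, which is almost surely `ε_{k+1}`. The empirical cross covariance is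
then `Ψ Ĉ_n + R̂_n`, where `R̂_n` averages `X_k ⊗ R_k`. Dividing by the eigenvalues of `Ĉ_n` along
its eigenvectors turns the first term into `Ψ P̂`, with `P̂` the projection onto the leading `K_n`
empirical eigenvectors, and multiplies `R̂_n` by a diagonal operator of norm at most `m_n`. The
error is thus at most `‖Ψ - Ψ P̂‖ + m_n ‖R̂_n‖` (`norm_pcEstimator_sub_le`).

Both `Ĉ_n - C` and `R̂_n` are `O(n^{-1/2})` in `L¹` (`LpMApproximable.exists_integral_norm_sub_le`).
One lemma covers both, because `X_k` and `R_k` are linear in `(X_k, X_{k+1})`. The average is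
compared with an independent copy, and the squared Hilbert–Schmidt norm of the difference is
expanded. A cross term at times `k < l` is a difference of two expectations. Exchanging the two
innovation sequences up to time `k + 1` preserves the law and turns one expectation into the other,
up to the effect of the exchange at time `l`. Approximability makes that effect summable in `l - k`,
so the second moment of the sum grows linearly in `n`. As `m_n / √n → 0`, the noise vanishes.

For the bias (`IsEigensystem.exists_bias_le`), fix `N` with `‖Ψ - Ψ P_N‖` small, `P_N` projecting
onto the first `N` eigenvectors of `C`; such `N` exists because `Ψ` is Hilbert–Schmidt. By Weyl's
inequality, closeness of `Ĉ_n` to `C` and a large `m_n` force `K_n > N`. The first `N` eigenvectors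
of `C` then lie almost in the range of `P̂`. Only spans are compared, so the choice of the empirical
eigenvectors, signs included, is irrelevant. -/

theorem hasSum_inner_sq {ι : Type*} (b : HilbertBasis ι ℝ H) (x : H) :
    HasSum (fun i => (inner ℝ (b i) x : ℝ) ^ 2) (‖x‖ ^ 2) := by
  have h : ∀ i, (inner ℝ (b i) x : ℝ) ^ 2 = inner ℝ x (b i) * inner ℝ (b i) x := fun i => by
    rw [real_inner_comm (b i) x, sq]
  simp only [h]
  exact real_inner_self_eq_norm_sq x ▸ b.hasSum_inner_mul_inner x x

variable [CompleteSpace H]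

/-- The operator norm is bounded by the Hilbert-Schmidt norm. -/
theorem norm_sq_le_of_hasSum {ι : Type*} (b : HilbertBasis ι ℝ H) (Φ : H →L[ℝ] H) {s : ℝ}
    (hs : HasSum (fun i => ‖Φ (b i)‖ ^ 2) s) : ‖Φ‖ ^ 2 ≤ s := by
  have hs0 : 0 ≤ s := hs.nonneg fun i => sq_nonneg _
  -- By Parseval `‖Φ* y‖² = ∑ ⟨Φ bᵢ, y⟩²`, to which Cauchy–Schwarz applies termwise.
  have key : ‖ContinuousLinearMap.adjoint Φ‖ ≤ √s := by
    refine ContinuousLinearMap.opNorm_le_bound _ (Real.sqrt_nonneg _) fun y => ?_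
    refine abs_le_of_sq_le_sq' ?_ (by positivity) |>.2
    rw [mul_pow, Real.sq_sqrt hs0]
    refine hasSum_le (fun i => ?_) (hasSum_inner_sq b _) (hs.mul_right (‖y‖ ^ 2))
    rw [ContinuousLinearMap.adjoint_inner_right, ← mul_pow, ← sq_abs]
    gcongr
    exact abs_real_inner_le_norm _ _
  rw [LinearIsometryEquiv.norm_map] at key
  calc ‖Φ‖ ^ 2 ≤ √s ^ 2 := by gcongr
    _ = s := Real.sq_sqrt hs0

/-- The right side is the squared Hilbert–Schmidt norm. Unlike the operator norm it expands into
inner products, whose expectations can be estimated one by one. -/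
theorem norm_sum_tensor_sq_le {ι : Type*} (s : Finset ι) (x y : ι → H) :
    ‖∑ k ∈ s, tensor (x k) (y k)‖ ^ 2 ≤
      ∑ k ∈ s, ∑ l ∈ s, (inner ℝ (x k) (x l) : ℝ) * inner ℝ (y k) (y l) := by
  obtain ⟨w, b, -⟩ := exists_hilbertBasis ℝ H
  refine norm_sq_le_of_hasSum b _ ?_
  have h : ∀ i, ‖(∑ k ∈ s, tensor (x k) (y k)) (b i)‖ ^ 2 =
      ∑ k ∈ s, ∑ l ∈ s, (inner ℝ (x k) (b i) * inner ℝ (b i) (x l) : ℝ) *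
        inner ℝ (y k) (y l) := by
    intro i
    rw [← real_inner_self_eq_norm_sq]
    simp only [sum_apply, tensor_apply, sum_inner, inner_sum,
      real_inner_smul_left, real_inner_smul_right]
    refine Finset.sum_congr rfl fun k _ => Finset.sum_congr rfl fun l _ => ?_
    rw [real_inner_comm (b i) (x k), real_inner_comm (b i) (x l)]
    rw [real_inner_comm (y k) (y l)]
    ring
  simp only [h]
  exact hasSum_sum fun k _ => hasSum_sum fun l _ => (b.hasSum_inner_mul_inner _ _).mul_right _

end HilbertSchmidt

/-! ### Spectral perturbation theory for ordered eigensystems. -/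

section Spectral

variable {H : Type v} [NormedAddCommGroup H] [InnerProductSpace ℝ H]

/-- The projection onto the span of the first `K` vectors of an orthonormal sequence. -/
noncomputable def spanProj (v : ℕ → H) (K : ℕ) : H →L[ℝ] H :=
  ∑ j ∈ Finset.range K, tensor (v j) (v j)

theorem spanProj_apply (v : ℕ → H) (K : ℕ) (x : H) :
    spanProj v K x = ∑ j ∈ Finset.range K, (inner ℝ (v j) x : ℝ) • v j := by
  simp [spanProj, tensor_apply]

theorem inner_sub_spanProj {v : ℕ → H} (hv : Orthonormal ℝ v) {K i : ℕ} (hi : i < K) (x : H) :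
    (inner ℝ (v i) (x - spanProj v K x) : ℝ) = 0 := by
  rw [inner_sub_right, spanProj_apply, hv.inner_right_sum _ (Finset.mem_range.2 hi), sub_self]

theorem norm_sub_spanProj_le {v : ℕ → H} (hv : Orthonormal ℝ v) (K : ℕ) (x : H) :
    ‖x - spanProj v K x‖ ≤ ‖x‖ := by
  have h0 : (inner ℝ (spanProj v K x) (x - spanProj v K x) : ℝ) = 0 := by
    conv_lhs => rw [spanProj_apply v K x]
    rw [← spanProj_apply v K x, spanProj_apply v K x, sum_inner]
    refine Finset.sum_eq_zero fun i hi => ?_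
    rw [real_inner_smul_left, ← spanProj_apply v K x,
      inner_sub_spanProj hv (Finset.mem_range.1 hi), mul_zero]
  have h1 := norm_add_sq_real (spanProj v K x) (x - spanProj v K x)
  rw [h0, add_sub_cancel] at h1
  refine abs_le_of_sq_le_sq' ?_ (norm_nonneg _) |>.2
  nlinarith [sq_nonneg ‖spanProj v K x‖]

theorem inner_spanProj (v : ℕ → H) (K : ℕ) (x y : H) :
    (inner ℝ (spanProj v K x) y : ℝ) = inner ℝ x (spanProj v K y) := by
  simp only [spanProj_apply, sum_inner, inner_sum, real_inner_smul_left, real_inner_smul_right]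
  refine Finset.sum_congr rfl fun i _ => ?_
  rw [real_inner_comm x (v i)]
  ring

/-- A diagonal operator with bounded coefficients is bounded. -/
theorem norm_sum_smul_inner_le {v : ℕ → H} (hv : Orthonormal ℝ v) (K : ℕ) (c : ℕ → ℝ) {M : ℝ}
    (hM : 0 ≤ M) (hc : ∀ j < K, |c j| ≤ M) (x : H) :
    ‖∑ j ∈ Finset.range K, (c j * inner ℝ (v j) x : ℝ) • v j‖ ≤ M * ‖x‖ := by
  refine abs_le_of_sq_le_sq' ?_ (by positivity) |>.2
  rw [← real_inner_self_eq_norm_sq, hv.inner_sum, mul_pow]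
  have hB := hv.sum_inner_products_le x (s := Finset.range K)
  calc _ ≤ ∑ j ∈ Finset.range K, M ^ 2 * ‖(inner ℝ (v j) x : ℝ)‖ ^ 2 := by
        refine Finset.sum_le_sum fun j hj => ?_
        have h1 := hc j (Finset.mem_range.1 hj)
        have h2 : c j ^ 2 ≤ M ^ 2 := sq_le_sq' (by linarith [(abs_le.1 h1).1]) (abs_le.1 h1).2
        rw [Real.norm_eq_abs, sq_abs]
        simp only [conj_trivial]
        nlinarith [sq_nonneg (inner ℝ (v j) x : ℝ)]
    _ ≤ _ := by
        rw [← Finset.mul_sum]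
        gcongr

variable {T : H →L[ℝ] H} {lam : ℕ → ℝ} {v : ℕ → H}

theorem IsEigensystem.nonneg (h : IsEigensystem T lam v)
    (hpos : ∀ x, 0 ≤ (inner ℝ (T x) x : ℝ)) (j : ℕ) : 0 ≤ lam j := by
  have := hpos (v j)
  rwa [h.apply_eq, real_inner_smul_left, real_inner_self_eq_norm_sq, h.orthonormal.1 j, one_pow,
    mul_one] at this

theorem IsEigensystem.apply_spanProj (h : IsEigensystem T lam v)
    (hT : ∀ x y, (inner ℝ (T x) y : ℝ) = inner ℝ x (T y)) (K : ℕ) (x : H) :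
    T (spanProj v K x) = spanProj v K (T x) := by
  simp only [spanProj_apply, map_sum, map_smul]
  refine Finset.sum_congr rfl fun j _ => ?_
  rw [← hT, h.apply_eq, real_inner_smul_left, smul_smul, mul_comm]

/-- `T (T e)` lies in the closed span of the eigenvectors, hence is orthogonal to `e`, and `⟨e, T (T
e)⟩ = ‖T e‖²`. -/
theorem IsEigensystem.apply_eq_zero (h : IsEigensystem T lam v)
    (hT : ∀ x y, (inner ℝ (T x) y : ℝ) = inner ℝ x (T y)) {e : H}
    (he : ∀ j, (inner ℝ (v j) e : ℝ) = 0) : T e = 0 := by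
  have hmem : T (T e) ∈ (Submodule.span ℝ {x | ∃ j, lam j ≠ 0 ∧ x = v j}).topologicalClosure := by
    rw [h.closure_span]
    exact Submodule.le_topologicalClosure _ ⟨T e, rfl⟩
  have hle : (Submodule.span ℝ {x | ∃ j, lam j ≠ 0 ∧ x = v j}).topologicalClosure ≤
      (innerSL ℝ e).ker := by
    refine Submodule.topologicalClosure_minimal _ (Submodule.span_le.2 ?_)
      (ContinuousLinearMap.isClosed_ker _)
    rintro x ⟨j, -, rfl⟩
    simp only [SetLike.mem_coe, LinearMap.mem_ker]
    exact (real_inner_comm _ _).trans (he j)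
  have h0 : (inner ℝ e (T (T e)) : ℝ) = 0 := hle hmem
  rwa [← hT, inner_self_eq_zero] at h0

variable [CompleteSpace H]

/-- Completing `v` to a Hilbert basis adds only vectors of the kernel, so `T` is diagonal in the
result. The index set stays abstract since the kernel may be of any size. -/
theorem IsEigensystem.exists_basis (h : IsEigensystem T lam v)
    (hT : ∀ x y, (inner ℝ (T x) y : ℝ) = inner ℝ x (T y)) :
    ∃ (s : Set H) (b : HilbertBasis s ℝ H), ∀ i, (∃ j, b i = v j) ∨ T (b i) = 0 := by
  obtain ⟨s, b, hs, hb⟩ := h.orthonormal.toSubtypeRange.exists_hilbertBasis_extension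
  refine ⟨s, b, fun i => ?_⟩
  by_cases hi : ∃ j, b i = v j
  · exact Or.inl hi
  · refine Or.inr (h.apply_eq_zero hT fun j => ?_)
    have hj : v j = b ⟨v j, hs ⟨j, rfl⟩⟩ := by rw [hb]
    rw [hj]
    refine b.orthonormal.2 fun hij => hi ⟨j, ?_⟩
    rw [← hij, ← hj]

theorem IsEigensystem.inner_apply_le (h : IsEigensystem T lam v)
    (hT : ∀ x y, (inner ℝ (T x) y : ℝ) = inner ℝ x (T y)) (h0 : ∀ j, 0 ≤ lam j) {j : ℕ} {x : H}
    (hx : ∀ i < j, (inner ℝ (v i) x : ℝ) = 0) : (inner ℝ (T x) x : ℝ) ≤ lam j * ‖x‖ ^ 2 := by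
  obtain ⟨s, b, hb⟩ := h.exists_basis hT
  refine hasSum_le (fun i => ?_) (b.hasSum_inner_mul_inner (T x) x)
    ((hasSum_inner_sq b x).mul_left (lam j))
  rw [hT]
  rcases hb i with ⟨k, hk⟩ | hk
  · rw [hk, h.apply_eq, real_inner_smul_right, real_inner_comm]
    rcases lt_or_ge k j with hkj | hkj
    · simp [hx k hkj]
    · nlinarith [h.antitone hkj, sq_nonneg (inner ℝ (v k) x : ℝ)]
  · rw [hk, inner_zero_right, zero_mul]
    exact mul_nonneg (h0 j) (sq_nonneg _)

theorem IsEigensystem.norm_apply_le (h : IsEigensystem T lam v)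
    (hT : ∀ x y, (inner ℝ (T x) y : ℝ) = inner ℝ x (T y)) (h0 : ∀ j, 0 ≤ lam j) {j : ℕ} {x : H}
    (hx : ∀ i < j, (inner ℝ (v i) x : ℝ) = 0) : ‖T x‖ ≤ lam j * ‖x‖ := by
  obtain ⟨s, b, hb⟩ := h.exists_basis hT
  refine abs_le_of_sq_le_sq' ?_ (mul_nonneg (h0 j) (norm_nonneg _)) |>.2
  rw [mul_pow]
  refine hasSum_le (fun i => ?_) (hasSum_inner_sq b (T x))
    ((hasSum_inner_sq b x).mul_left (lam j ^ 2))
  rw [← hT]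
  rcases hb i with ⟨k, hk⟩ | hk
  · rw [hk, h.apply_eq, real_inner_smul_left, mul_pow]
    rcases lt_or_ge k j with hkj | hkj
    · simp [hx k hkj]
    · have := h0 k
      have := h.antitone hkj
      gcongr
  · rw [hk, inner_zero_left, zero_pow two_ne_zero]
    positivity

/-- Weyl's inequality for the ordered eigenvalues. -/
theorem IsEigensystem.le_add_norm_sub {S : H →L[ℝ] H} {mu : ℕ → ℝ} {w : ℕ → H}
    (hS : IsEigensystem S mu w) (h : IsEigensystem T lam v)
    (hT : ∀ x y, (inner ℝ (T x) y : ℝ) = inner ℝ x (T y)) (h0 : ∀ j, 0 ≤ lam j) (j : ℕ) :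
    mu j ≤ lam j + ‖S - T‖ := by
  -- Dimension count: among combinations of the first `j + 1` eigenvectors of `S`, the `j`
  -- conditions of orthogonality to `v 0, …, v (j - 1)` leave a nonzero `x`. Its quadratic form is
  -- at least `mu j * ‖x‖²` for `S` and at most `lam j * ‖x‖²` for `T`.
  let F : (Fin (j + 1) → ℝ) →ₗ[ℝ] (Fin j → ℝ) :=
    LinearMap.pi fun i => ∑ k : Fin (j + 1),
      (inner ℝ (v i) (w k) : ℝ) • LinearMap.proj k
  have hker : F.ker ≠ ⊥ := LinearMap.ker_ne_bot_of_finrank_lt (by simp)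
  obtain ⟨c, hc, hc0⟩ := Submodule.exists_mem_ne_zero_of_ne_bot hker
  have hwo : Orthonormal ℝ fun k : Fin (j + 1) => w k :=
    hS.orthonormal.comp _ Fin.val_injective
  set x : H := ∑ k : Fin (j + 1), c k • w k with hxdef
  have hxv : ∀ i < j, (inner ℝ (v i) x : ℝ) = 0 := by
    intro i hi
    have h1 : F c ⟨i, hi⟩ = 0 := by rw [LinearMap.mem_ker.1 hc]; rfl
    rw [hxdef, inner_sum, ← h1]
    simp [F, real_inner_smul_right, mul_comm]
  have hnorm : ‖x‖ ^ 2 = ∑ k, c k ^ 2 := by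
    rw [← real_inner_self_eq_norm_sq, hxdef, hwo.inner_sum]
    simp [sq]
  have hpos : 0 < ‖x‖ ^ 2 := by
    rw [hnorm]
    obtain ⟨k, hk⟩ := Function.ne_iff.1 hc0
    exact Finset.sum_pos' (fun k _ => sq_nonneg _) ⟨k, Finset.mem_univ _, by
      have : c k ≠ 0 := hk
      positivity⟩
  have hSx : mu j * ‖x‖ ^ 2 ≤ (inner ℝ (S x) x : ℝ) := by
    have h1 : S x = ∑ k : Fin (j + 1), (c k * mu k) • w k := by
      simp [hxdef, map_sum, hS.apply_eq, smul_smul]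
    rw [h1, hnorm]
    conv_rhs => rw [hxdef]
    rw [hwo.inner_sum, Finset.mul_sum]
    refine Finset.sum_le_sum fun k _ => ?_
    have := hS.antitone (Nat.lt_succ_iff.1 k.2)
    simp only [conj_trivial]
    nlinarith [sq_nonneg (c k)]
  have hTx := h.inner_apply_le hT h0 hxv
  have hd : (inner ℝ ((S - T) x) x : ℝ) ≤ ‖S - T‖ * ‖x‖ ^ 2 := by
    calc _ ≤ ‖(S - T) x‖ * ‖x‖ := real_inner_le_norm _ _
      _ ≤ ‖S - T‖ * ‖x‖ * ‖x‖ := by gcongr; exact ContinuousLinearMap.le_opNorm _ _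
      _ = _ := by ring
  rw [sub_apply, inner_sub_left] at hd
  refine le_of_mul_le_mul_right (a := ‖x‖ ^ 2) ?_ hpos
  nlinarith

/-- Eigenvectors of `S` are almost in the span of the leading eigenvectors of a nearby `T`. -/
theorem IsEigensystem.mul_norm_sub_spanProj_le (h : IsEigensystem T lam v)
    (hT : ∀ x y, (inner ℝ (T x) y : ℝ) = inner ℝ x (T y)) (h0 : ∀ j, 0 ≤ lam j)
    {S : H →L[ℝ] H} {μ : ℝ} (hμ : 0 ≤ μ) {e : H} (he : ‖e‖ = 1) (hSe : S e = μ • e) (K : ℕ) :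
    (μ - lam K) * ‖e - spanProj v K e‖ ≤ ‖S - T‖ := by
  -- With `Q = 1 - spanProj v K`, which commutes with `T`, this is `μ Q e = Q S e = T Q e + Q (S -
  -- T) e`; on the range of `Q` the operator `T` has norm at most `lam K`.
  have h1 : μ • (e - spanProj v K e) =
      T (e - spanProj v K e) + ((S - T) e - spanProj v K ((S - T) e)) := by
    rw [map_sub T, h.apply_spanProj hT, sub_apply, hSe, map_sub, map_smul,
      smul_sub]
    abel
  have h2 : ‖T (e - spanProj v K e)‖ ≤ lam K * ‖e - spanProj v K e‖ :=
    h.norm_apply_le hT h0 fun i hi => inner_sub_spanProj h.orthonormal hi e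
  have h3 : ‖(S - T) e - spanProj v K ((S - T) e)‖ ≤ ‖S - T‖ :=
    (norm_sub_spanProj_le h.orthonormal K _).trans
      ((ContinuousLinearMap.le_opNorm _ _).trans (by rw [he, mul_one]))
  have h4 := norm_add_le (T (e - spanProj v K e)) ((S - T) e - spanProj v K ((S - T) e))
  rw [← h1, norm_smul, Real.norm_eq_abs, abs_of_nonneg hμ] at h4
  nlinarith

end Spectral

/-! ### The random truncation level. -/

section Truncation

/-- `sSup` of an empty or unbounded set of naturals is `0`, so an index below it certifies an
attained maximum; monotonicity carries the bound down from there. -/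
theorem lt_truncationLevel {lam : ℕ → ℝ} (hanti : Antitone lam) {m : ℝ} {j : ℕ}
    (hj : j < truncationLevel lam m) : 0 < lam j ∧ (lam j)⁻¹ ≤ m := by
  have hB : j < indexB lam m := lt_of_lt_of_le hj ((min_le_left _ _).trans (min_le_left _ _))
  have hne : {k : ℕ | ∃ j, k = j + 1 ∧ 0 < lam j ∧ (lam j)⁻¹ ≤ m}.Nonempty := by
    by_contra hne
    rw [Set.not_nonempty_iff_eq_empty] at hne
    rw [indexB, hne] at hB
    simp at hB
  have hbdd : BddAbove {k : ℕ | ∃ j, k = j + 1 ∧ 0 < lam j ∧ (lam j)⁻¹ ≤ m} := by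
    by_contra hb
    rw [indexB, Nat.sSup_of_not_bddAbove hb] at hB
    exact absurd hB (Nat.not_lt_zero _)
  obtain ⟨i, hi, hpos, hle⟩ := Nat.sSup_mem hne hbdd
  have hji : j ≤ i := by
    rw [indexB, hi] at hB
    omega
  have := hanti hji
  exact ⟨hpos.trans_le this, (inv_anti₀ hpos this).trans hle⟩

/-- The limit `0` bounds both index sets; otherwise `sSup` would default to `0` and the lower bound
could fail. -/
theorem le_truncationLevel {lam : ℕ → ℝ} (hlim : Tendsto lam atTop (𝓝 0)) {m : ℝ} {N : ℕ}
    (hm : 0 < m) (hN : (N : ℝ) ≤ m) (h1 : ∀ j < N, m⁻¹ ≤ lam j)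
    (h2 : ∀ j < N, m⁻¹ ≤ spectralGap lam j) : N ≤ truncationLevel lam m := by
  rcases Nat.eq_zero_or_pos N with rfl | hN0
  · exact Nat.zero_le _
  have hm' : 0 < m⁻¹ := inv_pos.2 hm
  obtain ⟨M, hM⟩ := eventually_atTop.1 (hlim.eventually_lt_const hm')
  have hfin : ∀ j, 0 < lam j → (lam j)⁻¹ ≤ m → j < M := by
    intro j hj hjm
    by_contra hMj
    exact absurd (hM j (not_lt.1 hMj)) (not_lt.2 (inv_le_of_inv_le₀ hj hjm))
  refine le_min (le_min ?_ ?_) (Nat.le_floor hN)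
  · refine le_csSup ⟨M, ?_⟩ ⟨N - 1, by omega, hm'.trans_le (h1 _ (by omega)),
      inv_le_of_inv_le₀ hm (h1 _ (by omega))⟩
    rintro k ⟨j, rfl, hj, hjm⟩
    exact hfin j hj hjm
  · have hgap : Tendsto (fun j => lam j - lam (j + 1)) atTop (𝓝 0) := by
      simpa using hlim.sub (hlim.comp (tendsto_add_atTop_nat 1))
    obtain ⟨M', hM'⟩ := eventually_atTop.1 (hgap.eventually_lt_const hm')
    refine le_csSup ⟨M' + 1, ?_⟩ ⟨hN0, fun j hj => ⟨hm'.trans_le (h2 j hj),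
      inv_le_of_inv_le₀ hm (h2 j hj)⟩⟩
    rintro k ⟨-, hk⟩
    by_contra hlt
    -- The gap at `M' + 1` is a minimum that includes `lam M' - lam (M' + 1)`, already known to be
    -- below `m⁻¹`.
    have hgapM := hk (M' + 1) (by omega)
    have h3 : m⁻¹ ≤ spectralGap lam (M' + 1) := inv_le_of_inv_le₀ hgapM.1 hgapM.2
    exact absurd (hM' M' le_rfl) (not_lt.2 (h3.trans (min_le_left _ _)))

end Truncation

/-! ### Error decomposition and control of the bias. -/

section Consistency

variable {H : Type v} [NormedAddCommGroup H] [InnerProductSpace ℝ H]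

/-- Decomposition of the principal components estimator into a bias and a noise part. -/
theorem pcEstimator_eq {T : H →L[ℝ] H} {lam : ℕ → ℝ} {v : ℕ → H} (h : IsEigensystem T lam v)
    (Ψ R : H →L[ℝ] H) {K : ℕ} (hK : ∀ j < K, lam j ≠ 0) (x : H) :
    pcEstimator (Ψ ∘L T + R) lam v K x = Ψ (spanProj v K x) +
      R (∑ j ∈ Finset.range K, ((lam j)⁻¹ * inner ℝ (v j) x : ℝ) • v j) := by
  simp only [pcEstimator, sum_apply, tensor_apply, spanProj_apply, map_sum, map_smul,
    ← Finset.sum_add_distrib]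
  refine Finset.sum_congr rfl fun j hj => ?_
  have := hK j (Finset.mem_range.1 hj)
  rw [add_apply, ContinuousLinearMap.comp_apply, h.apply_eq, map_smul, smul_add, smul_smul,
    inv_mul_cancel₀ this, one_smul, smul_add, smul_smul, mul_comm]

theorem norm_pcEstimator_sub_le {T : H →L[ℝ] H} {lam : ℕ → ℝ} {v : ℕ → H}
    (h : IsEigensystem T lam v) (Ψ R : H →L[ℝ] H) {m : ℝ} (hm : 0 ≤ m) :
    ‖pcEstimator (Ψ ∘L T + R) lam v (truncationLevel lam m) - Ψ‖ ≤
      ‖Ψ - Ψ ∘L spanProj v (truncationLevel lam m)‖ + m * ‖R‖ := by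
  set K := truncationLevel lam m
  have hK : ∀ j < K, 0 < lam j ∧ (lam j)⁻¹ ≤ m := fun j hj => lt_truncationLevel h.antitone hj
  refine ContinuousLinearMap.opNorm_le_bound _ (by positivity) fun x => ?_
  rw [sub_apply, pcEstimator_eq h Ψ R fun j hj => (hK j hj).1.ne', add_mul]
  have h1 : ‖Ψ x - Ψ (spanProj v K x)‖ ≤ ‖Ψ - Ψ ∘L spanProj v K‖ * ‖x‖ :=
    (Ψ - Ψ ∘L spanProj v K).le_opNorm x
  have h2 := norm_sum_smul_inner_le h.orthonormal K (fun j => (lam j)⁻¹) hm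
    (fun j hj => by rw [abs_of_nonneg (inv_nonneg.2 (hK j hj).1.le)]; exact (hK j hj).2) x
  have h3 := R.le_opNorm (∑ j ∈ Finset.range K, ((lam j)⁻¹ * inner ℝ (v j) x : ℝ) • v j)
  calc _ = ‖R (∑ j ∈ Finset.range K, ((lam j)⁻¹ * inner ℝ (v j) x : ℝ) • v j) -
        (Ψ x - Ψ (spanProj v K x))‖ := by congr 1; abel
    _ ≤ ‖R (∑ j ∈ Finset.range K, ((lam j)⁻¹ * inner ℝ (v j) x : ℝ) • v j)‖ +
        ‖Ψ x - Ψ (spanProj v K x)‖ := norm_sub_le _ _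
    _ ≤ ‖R‖ * (m * ‖x‖) + ‖Ψ - Ψ ∘L spanProj v K‖ * ‖x‖ := by
        refine add_le_add (h3.trans ?_) h1
        gcongr
    _ = _ := by ring

/-- On `y = x - spanProj w K x`, split `Ψ` by `spanProj v N`. Moving the self-adjoint projection
across gives `⟨v j, y⟩ = ⟨v j - spanProj w K (v j), x⟩`. -/
theorem norm_sub_comp_spanProj_le (Ψ : H →L[ℝ] H) {v w : ℕ → H} (hv : Orthonormal ℝ v)
    (hw : Orthonormal ℝ w) (N K : ℕ) :
    ‖Ψ - Ψ ∘L spanProj w K‖ ≤ ‖Ψ - Ψ ∘L spanProj v N‖ +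
      ‖Ψ‖ * ∑ j ∈ Finset.range N, ‖v j - spanProj w K (v j)‖ := by
  refine ContinuousLinearMap.opNorm_le_bound _ (by positivity) fun x => ?_
  set y := x - spanProj w K x with hy
  have hsplit : (Ψ - Ψ ∘L spanProj w K) x = (Ψ - Ψ ∘L spanProj v N) y + Ψ (spanProj v N y) := by
    simp [hy]
  have h1 : ‖(Ψ - Ψ ∘L spanProj v N) y‖ ≤ ‖Ψ - Ψ ∘L spanProj v N‖ * ‖x‖ :=
    (ContinuousLinearMap.le_opNorm _ _).trans (by gcongr; exact norm_sub_spanProj_le hw K x)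
  have h2 : ‖spanProj v N y‖ ≤ (∑ j ∈ Finset.range N, ‖v j - spanProj w K (v j)‖) * ‖x‖ := by
    rw [spanProj_apply, Finset.sum_mul]
    refine (norm_sum_le _ _).trans (Finset.sum_le_sum fun j _ => ?_)
    rw [norm_smul, hv.1 j, mul_one, hy, inner_sub_right, ← inner_spanProj, ← inner_sub_left]
    exact abs_real_inner_le_norm _ _
  rw [hsplit]
  calc _ ≤ ‖(Ψ - Ψ ∘L spanProj v N) y‖ + ‖Ψ (spanProj v N y)‖ := norm_add_le _ _
    _ ≤ ‖Ψ - Ψ ∘L spanProj v N‖ * ‖x‖ +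
        ‖Ψ‖ * ((∑ j ∈ Finset.range N, ‖v j - spanProj w K (v j)‖) * ‖x‖) :=
      add_le_add h1 ((Ψ.le_opNorm _).trans (by gcongr))
    _ = _ := by ring

variable [CompleteSpace H]

theorem summable_norm_sq {ι : Type*} (b : HilbertBasis ι ℝ H) {Ψ : H →L[ℝ] H}
    (hΨ : hilbertSchmidtNorm Ψ < ∞) : Summable fun i => ‖Ψ (b i)‖ ^ 2 := by
  rw [hilbertSchmidtNorm_eq b, ENNReal.rpow_lt_top_iff_of_pos (by norm_num)] at hΨ
  have h := ENNReal.summable_toReal hΨ.ne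
  simpa using h

/-- The squared Hilbert–Schmidt norm of the difference is a tail of the convergent series `∑ ‖Ψ (b
i)‖²`. -/
theorem tendsto_norm_sub_comp_spanProj (b : HilbertBasis ℕ ℝ H) {Ψ : H →L[ℝ] H}
    (hΨ : hilbertSchmidtNorm Ψ < ∞) :
    Tendsto (fun N => ‖Ψ - Ψ ∘L spanProj b N‖) atTop (𝓝 0) := by
  have hs := (summable_norm_sq b hΨ).hasSum
  set s := ∑' i, ‖Ψ (b i)‖ ^ 2
  have hbound : ∀ N, ‖Ψ - Ψ ∘L spanProj b N‖ ^ 2 ≤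
      s - ∑ j ∈ Finset.range N, ‖Ψ (b j)‖ ^ 2 := by
    intro N
    refine norm_sq_le_of_hasSum b _ ?_
    have h1 : HasSum (fun j => if j ∈ Finset.range N then ‖Ψ (b j)‖ ^ 2 else 0)
        (∑ j ∈ Finset.range N, ‖Ψ (b j)‖ ^ 2) := by
      convert hasSum_sum_of_ne_finset_zero (L := SummationFilter.unconditional ℕ)
        (f := fun j => if j ∈ Finset.range N then ‖Ψ (b j)‖ ^ 2 else 0) (s := Finset.range N)
        (fun j hj => if_neg hj) using 1
      exact Finset.sum_congr rfl fun j hj => (if_pos hj).symm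
    have hterm : ∀ j, ‖(Ψ - Ψ ∘L spanProj b N) (b j)‖ ^ 2 =
        ‖Ψ (b j)‖ ^ 2 - if j ∈ Finset.range N then ‖Ψ (b j)‖ ^ 2 else 0 := fun j => by
      have hproj : spanProj b N (b j) = if j ∈ Finset.range N then b j else 0 := by
        rw [spanProj_apply]
        simp [orthonormal_iff_ite.1 b.orthonormal]
      rw [sub_apply, ContinuousLinearMap.comp_apply, hproj]
      split_ifs <;> simp
    simp only [hterm]
    exact hs.sub h1
  have h2 : Tendsto (fun N => ‖Ψ - Ψ ∘L spanProj b N‖ ^ 2) atTop (𝓝 0) := by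
    refine squeeze_zero (fun N => sq_nonneg _) hbound ?_
    simpa using hs.tendsto_sum_nat.const_sub s
  simpa using h2.sqrt

theorem IsEigensystem.exists_hilbertBasis_coe_eq {C : H →L[ℝ] H} {lam : ℕ → ℝ} {v : ℕ → H}
    (hC : IsEigensystem C lam v) (hrank : DenseRange C) : ∃ b : HilbertBasis ℕ ℝ H, ⇑b = v := by
  refine ⟨HilbertBasis.mk hC.orthonormal ?_, HilbertBasis.coe_mk _ _⟩
  have h1 : (LinearMap.range (C : H →ₗ[ℝ] H)).topologicalClosure = ⊤ := by
    rw [← Submodule.dense_iff_topologicalClosure_eq_top]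
    exact hrank
  rw [← h1, ← hC.closure_span]
  refine Submodule.topologicalClosure_mono (Submodule.span_mono ?_)
  rintro x ⟨j, -, rfl⟩
  exact ⟨j, rfl⟩

theorem spectralGap_sub_le {lam mu : ℕ → ℝ} {δ : ℝ} (h : ∀ j, |lam j - mu j| ≤ δ) (j : ℕ) :
    spectralGap lam j - 2 * δ ≤ spectralGap mu j := by
  have h' := fun j => abs_le.1 (h j)
  cases j with
  | zero =>
    simp only [spectralGap]
    linarith [h' 0, h' 1]
  | succ j =>
    simp only [spectralGap]
    refine le_min ?_ ?_
    · linarith [h' j, h' (j + 1), min_le_left (lam j - lam (j + 1)) (lam (j + 1) - lam (j + 2))]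
    · linarith [h' (j + 1), h' (j + 2),
        min_le_right (lam j - lam (j + 1)) (lam (j + 1) - lam (j + 2))]

theorem spectralGap_pos {lam : ℕ → ℝ} (h : StrictAnti lam) (j : ℕ) : 0 < spectralGap lam j := by
  cases j with
  | zero => exact sub_pos.2 (h zero_lt_one)
  | succ j => exact lt_min (sub_pos.2 (h (Nat.lt_succ_self _))) (sub_pos.2 (h (Nat.lt_succ_self _)))

theorem exists_pos_forall_lt_le (N : ℕ) {f : ℕ → ℝ} (hf : ∀ j, 0 < f j) :
    ∃ ρ > 0, ∀ j < N, ρ ≤ f j := by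
  induction N with
  | zero => exact ⟨1, one_pos, fun j hj => absurd hj (Nat.not_lt_zero _)⟩
  | succ N ih =>
    obtain ⟨ρ, hρ, h⟩ := ih
    refine ⟨min ρ (f N), lt_min hρ (hf N), fun j hj => ?_⟩
    rcases Nat.lt_succ_iff_lt_or_eq.1 hj with hj | rfl
    · exact (min_le_left _ _).trans (h j hj)
    · exact min_le_right _ _

/-- The bias of the estimator is small if the estimated covariance operator is close to the true
one and the threshold is large. -/
theorem IsEigensystem.exists_bias_le {C : H →L[ℝ] H} {lam : ℕ → ℝ} {v : ℕ → H}
    (hC : IsEigensystem C lam v) (hsymm : ∀ x y, (inner ℝ (C x) y : ℝ) = inner ℝ x (C y))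
    (hpos : ∀ x, 0 ≤ (inner ℝ (C x) x : ℝ)) (hrank : DenseRange C)
    (hinj : Function.Injective lam) {Ψ : H →L[ℝ] H} (hΨ : hilbertSchmidtNorm Ψ < ∞)
    {η : ℝ} (hη : 0 < η) :
    ∃ δ > 0, ∃ M : ℝ, ∀ (T : H →L[ℝ] H) (mu : ℕ → ℝ) (w : ℕ → H) (m : ℝ),
      IsEigensystem T mu w → (∀ x y, (inner ℝ (T x) y : ℝ) = inner ℝ x (T y)) →
      (∀ x, 0 ≤ (inner ℝ (T x) x : ℝ)) → Tendsto mu atTop (𝓝 0) → ‖T - C‖ ≤ δ → M ≤ m →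
      ‖Ψ - Ψ ∘L spanProj w (truncationLevel mu m)‖ ≤ η := by
  obtain ⟨b, hb⟩ := hC.exists_hilbertBasis_coe_eq hrank
  have hlim := tendsto_norm_sub_comp_spanProj b hΨ
  rw [hb] at hlim
  obtain ⟨N, hN⟩ := (hlim.eventually_lt_const (half_pos hη)).exists
  have hanti : StrictAnti lam := hC.antitone.strictAnti_of_injective hinj
  have hlam0 := hC.nonneg hpos
  have hlampos : ∀ j, 0 < lam j := fun j =>
    (hlam0 (j + 1)).trans_lt (hanti (Nat.lt_succ_self j))
  -- `ρ` bounds the first `N + 1` eigenvalues and gaps of `C` from below. A perturbation `δ ≤ ρ / 4`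
  -- leaves the empirical ones at least `ρ / 2`, which `m ≥ 2 / ρ` admits.
  obtain ⟨ρ, hρ, hρle⟩ := exists_pos_forall_lt_le (N + 1)
    (f := fun j => min (lam j) (spectralGap lam j))
    fun j => lt_min (hlampos j) (spectralGap_pos hanti j)
  set A : ℝ := ‖Ψ‖ * N + 1 with hA
  have hApos : 0 < A := by positivity
  -- The second entry makes `‖Ψ‖ * N * (2 * δ / ρ) ≤ η / 2`; the `+ 1` in `A` only avoids division
  -- by zero.
  set δ : ℝ := min (ρ / 4) (η * ρ / (4 * A)) with hδ
  have hδpos : 0 < δ := lt_min (by positivity) (by positivity)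
  have hδ1 : δ ≤ ρ / 4 := min_le_left _ _
  have hδ2 : δ * (4 * A) ≤ η * ρ := (le_div_iff₀ (by positivity)).1 (min_le_right _ _)
  refine ⟨δ, hδpos, max (N + 1) (2 / ρ), fun T mu w m hTe hTs hTp hTlim hTC hm => ?_⟩
  have hmu0 := hTe.nonneg hTp
  have hmN : ((N + 1 : ℕ) : ℝ) ≤ m := by push_cast; exact (le_max_left _ _).trans hm
  have hmρ : 2 / ρ ≤ m := (le_max_right _ _).trans hm
  have hmpos : 0 < m := lt_of_lt_of_le (by positivity) hmρ
  have hminv : m⁻¹ ≤ ρ / 2 := by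
    rw [← inv_div]
    exact inv_anti₀ (by positivity) hmρ
  have hCT : ‖C - T‖ ≤ δ := by rwa [norm_sub_rev]
  have hdiff : ∀ j, |lam j - mu j| ≤ δ := fun j => abs_sub_le_iff.2
    ⟨by linarith [hC.le_add_norm_sub hTe hTs hmu0 j],
      by linarith [hTe.le_add_norm_sub hC hsymm hlam0 j]⟩
  set K := truncationLevel mu m with hKdef
  have hK : N + 1 ≤ K := by
    refine le_truncationLevel hTlim hmpos hmN (fun j hj => ?_) (fun j hj => ?_)
    · linarith [(abs_le.1 (hdiff j)).2, hρle j hj, min_le_left (lam j) (spectralGap lam j)]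
    · linarith [spectralGap_sub_le hdiff j, hρle j hj, min_le_right (lam j) (spectralGap lam j)]
  have hterm : ∀ j ∈ Finset.range N, ‖v j - spanProj w K (v j)‖ ≤ 2 * δ / ρ := by
    intro j hj
    have hjN := Finset.mem_range.1 hj
    -- The roles are reversed: the true eigenvector `v j` is projected onto the empirical span. This
    -- needs only the gap between `lam j` and `mu K`.
    have h1 := hTe.mul_norm_sub_spanProj_le hTs hmu0 (hlam0 j) (hC.orthonormal.1 j)
      (hC.apply_eq j) K
    have hgap : spectralGap lam j ≤ lam j - lam (j + 1) := by
      cases j with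
      | zero => exact le_rfl
      | succ j => exact min_le_right _ _
    have h2 : ρ / 2 ≤ lam j - mu K := by
      have h3 := hTe.antitone hK
      have h4 := (abs_le.1 (hdiff (N + 1))).1
      have h5 := hC.antitone (show j + 1 ≤ N + 1 by omega)
      linarith [hρle j (by omega), min_le_right (lam j) (spectralGap lam j)]
    rw [le_div_iff₀ hρ]
    nlinarith [norm_nonneg (v j - spanProj w K (v j))]
  have hsum : ∑ j ∈ Finset.range N, ‖v j - spanProj w K (v j)‖ ≤ N * (2 * δ / ρ) := by
    refine (Finset.sum_le_sum hterm).trans ?_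
    simp
  refine (norm_sub_comp_spanProj_le Ψ hC.orthonormal hTe.orthonormal N K).trans ?_
  have h6 : ‖Ψ‖ * ∑ j ∈ Finset.range N, ‖v j - spanProj w K (v j)‖ ≤ A * (2 * δ / ρ) := by
    calc _ ≤ ‖Ψ‖ * (N * (2 * δ / ρ)) := by gcongr
      _ = (‖Ψ‖ * N) * (2 * δ / ρ) := by ring
      _ ≤ _ := by gcongr; linarith
  have h7 : A * (2 * δ / ρ) ≤ η / 2 := by
    rw [← mul_div_assoc, div_le_iff₀ hρ]
    linarith
  linarith

end Consistency

/-! ### Empirical covariance operators. -/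

section Empirical

variable {H : Type v} [NormedAddCommGroup H] [InnerProductSpace ℝ H] {Ω : Type u}

theorem empiricalCross_apply (X Y : ℕ → Ω → H) (n : ℕ) (ω : Ω) (z : H) :
    empiricalCross X Y n ω z =
      (n : ℝ)⁻¹ • ∑ k ∈ Finset.Icc 1 n, (inner ℝ (X k ω) z : ℝ) • Y k ω := by
  simp [empiricalCross, tensor_apply]

theorem inner_empiricalCross_left (X : ℕ → Ω → H) (n : ℕ) (ω : Ω) (y z : H) :
    (inner ℝ (empiricalCross X X n ω y) z : ℝ) = inner ℝ y (empiricalCross X X n ω z) := by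
  simp only [empiricalCross_apply, real_inner_smul_left, real_inner_smul_right, sum_inner,
    inner_sum]
  congr 1
  refine Finset.sum_congr rfl fun k _ => ?_
  rw [real_inner_comm (X k ω) y]
  ring

theorem inner_empiricalCross_self_nonneg (X : ℕ → Ω → H) (n : ℕ) (ω : Ω) (z : H) :
    0 ≤ (inner ℝ (empiricalCross X X n ω z) z : ℝ) := by
  simp only [empiricalCross_apply, real_inner_smul_left, sum_inner]
  refine mul_nonneg (by positivity) (Finset.sum_nonneg fun k _ => mul_self_nonneg _)

theorem tendsto_inner_of_orthonormal {v : ℕ → H} (hv : Orthonormal ℝ v) (x : H) :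
    Tendsto (fun j => (inner ℝ x (v j) : ℝ)) atTop (𝓝 0) := by
  have h := (hv.inner_products_summable (x := x)).tendsto_atTop_zero
  have h1 := h.sqrt
  simp only [Real.sqrt_sq (norm_nonneg _), Real.sqrt_zero] at h1
  refine (tendsto_zero_iff_norm_tendsto_zero.2 h1).congr fun j => real_inner_comm _ _

/-- The operator has finite rank, and by Bessel `⟨X k ω, w j⟩ → 0` for each of the finitely many
`k`. -/
theorem tendsto_eigenvalue_empiricalCross {X : ℕ → Ω → H} {n : ℕ} {ω : Ω} {mu : ℕ → ℝ}
    {w : ℕ → H} (h : IsEigensystem (empiricalCross X X n ω) mu w) :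
    Tendsto mu atTop (𝓝 0) := by
  have h1 : Tendsto (fun j => empiricalCross X X n ω (w j)) atTop (𝓝 0) := by
    simp only [empiricalCross_apply]
    have h2 : Tendsto (fun j => (n : ℝ)⁻¹ • ∑ k ∈ Finset.Icc 1 n,
        (inner ℝ (X k ω) (w j) : ℝ) • X k ω) atTop
        (𝓝 ((n : ℝ)⁻¹ • ∑ k ∈ Finset.Icc 1 n, (0 : ℝ) • X k ω)) :=
      (tendsto_finsetSum _ fun k _ =>
        (tendsto_inner_of_orthonormal h.orthonormal _).smul_const _).const_smul _
    simpa using h2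
  rw [tendsto_zero_iff_norm_tendsto_zero] at h1 ⊢
  refine h1.congr fun j => ?_
  rw [h.apply_eq, norm_smul, h.orthonormal.1 j, mul_one]

end Empirical

/-! ### The joint law of the innovations and their copy, and its symmetries. -/

section PathSpace

variable {Ω : Type u} [MeasurableSpace Ω] {S : Type w} [MeasurableSpace S]

/-- The paths of a process indexed by `ℤ` (index `false`) and of its independent copy
(index `true`). -/
def pairPath (δ : ℤ → Ω → S) (z : Ω × Ω) : Bool × ℤ → S :=
  fun i => δ i.2 (if i.1 then z.2 else z.1)

theorem measurable_pairPath {δ : ℤ → Ω → S} (hδ : ∀ i, Measurable (δ i)) :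
    Measurable (pairPath δ) := by
  refine measurable_pi_lambda _ fun i => ?_
  rcases i with ⟨_ | _, i⟩
  · exact (hδ i).comp measurable_fst
  · exact (hδ i).comp measurable_snd

theorem map_pairPath {P : Measure Ω} [IsProbabilityMeasure P] {δ : ℤ → Ω → S}
    (hδ : ∀ i, Measurable (δ i)) (hind : iIndepFun δ P)
    (hid : ∀ i, IdentDistrib (δ i) (δ 0) P P) :
    (P.prod P).map (pairPath δ) = Measure.infinitePi fun _ : Bool × ℤ => P.map (δ 0) := by
  have : IsProbabilityMeasure (P.map (δ 0)) := Measure.isProbabilityMeasure_map (hδ 0).aemeasurable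
  refine Measure.eq_infinitePi _ fun s t ht => ?_
  classical
  -- Padding with `Set.univ` replaces `s` by the full rectangle `Bool × J`, so that independence can
  -- be applied to each copy over the same `J`.
  set t' : Bool × ℤ → Set S := fun i => if i ∈ s then t i else Set.univ with ht'
  have ht'm : ∀ i, MeasurableSet (t' i) := fun i => by
    simp only [ht']
    split_ifs
    exacts [ht i, MeasurableSet.univ]
  set J : Finset ℤ := s.image Prod.snd with hJ
  have hset : pairPath δ ⁻¹' (Set.pi s t) =
      (⋂ j ∈ J, δ j ⁻¹' t' (false, j)) ×ˢ (⋂ j ∈ J, δ j ⁻¹' t' (true, j)) := by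
    ext z
    simp only [Set.mem_preimage, Set.mem_pi, Finset.mem_coe, Set.mem_prod, Set.mem_iInter]
    constructor
    · intro h
      refine ⟨fun j _ => ?_, fun j _ => ?_⟩
      · simp only [ht']
        split_ifs with hjs
        exacts [h _ hjs, Set.mem_univ _]
      · simp only [ht']
        split_ifs with hjs
        exacts [h _ hjs, Set.mem_univ _]
    · rintro ⟨h1, h2⟩ ⟨b, j⟩ hi
      have hj : j ∈ J := Finset.mem_image.2 ⟨_, hi, rfl⟩
      cases b
      · simpa [ht', hi, pairPath] using h1 j hj
      · simpa [ht', hi, pairPath] using h2 j hj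
  have hP : ∀ b, P (⋂ j ∈ J, δ j ⁻¹' t' (b, j)) = ∏ j ∈ J, P.map (δ 0) (t' (b, j)) := by
    intro b
    rw [hind.measure_inter_preimage_eq_mul J fun j _ => ht'm (b, j)]
    refine Finset.prod_congr rfl fun j _ => ?_
    rw [← (hid j).map_eq, Measure.map_apply (hδ j) (ht'm _)]
  rw [Measure.map_apply (measurable_pairPath hδ) (MeasurableSet.pi s.countable_toSet
    fun i _ => ht i), hset, Measure.prod_prod, hP, hP]
  have hsub : s ⊆ Finset.univ ×ˢ J := fun i hi =>
    Finset.mem_product.2 ⟨Finset.mem_univ _, Finset.mem_image.2 ⟨i, hi, rfl⟩⟩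
  have h1 : ∏ i ∈ s, P.map (δ 0) (t i) = ∏ i ∈ Finset.univ ×ˢ J, P.map (δ 0) (t' i) := by
    rw [← Finset.prod_subset hsub fun i _ hi => by simp [ht', hi]]
    exact Finset.prod_congr rfl fun i hi => by simp [ht', hi]
  rw [h1, Finset.prod_product, Fintype.prod_bool, mul_comm]

/-- Coordinates of an i.i.d. family may be relabelled injectively; the swaps and time shifts below
are instances. -/
theorem measurePreserving_reindex (μ : Measure S) [IsProbabilityMeasure μ]
    {e : Bool × ℤ → Bool × ℤ} (he : Function.Injective e) :
    MeasurePreserving (fun (x : Bool × ℤ → S) i => x (e i))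
      (Measure.infinitePi fun _ => μ) (Measure.infinitePi fun _ => μ) :=
  ⟨by fun_prop, Measure.map_infinitePi_infinitePi_of_inj he⟩

/-- Exchange the two copies at all times up to `j`. -/
def swapIndex (j : ℤ) (i : Bool × ℤ) : Bool × ℤ := (if i.2 ≤ j then !i.1 else i.1, i.2)

theorem swapIndex_injective (j : ℤ) : Function.Injective (swapIndex j) := by
  rintro ⟨b, i⟩ ⟨c, k⟩ h
  simp only [swapIndex, Prod.mk.injEq] at h
  obtain ⟨h1, rfl⟩ := h
  split_ifs at h1 <;> simpa using h1

/-- Shift the time by `j`, and exchange the two copies if `b = true`. -/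
def shiftIndex (b : Bool) (j : ℤ) (i : Bool × ℤ) : Bool × ℤ := (xor i.1 b, i.2 + j)

theorem shiftIndex_injective (b : Bool) (j : ℤ) : Function.Injective (shiftIndex b j) := by
  rintro ⟨c, i⟩ ⟨d, k⟩ h
  simpa [shiftIndex] using h

end PathSpace

/-! ### From approximability to swaps of two copies. -/

section Coupling

variable {H : Type v} [NormedAddCommGroup H]

/-- Two copies `Y false`, `Y true` of a sequence, together with measure preserving maps `θ j`
which exchange the copies up to time `j` and change the values after time `j + p` by
at most `a p` in `L⁴`. -/
structure IsSwapApproximable [MeasurableSpace H] {E : Type w} [MeasurableSpace E] (π : Measure E)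
    (Y : Bool → ℕ → E → H) (θ : ℕ → E → E) (M : ℝ) (a : ℕ → ℝ) : Prop where
  memLp : ∀ b n, 1 ≤ n → MemLp (Y b n) 4 π
  norm_le : ∀ b n, 1 ≤ n → (eLpNorm (Y b n) 4 π).toReal ≤ M
  identDistrib : ∀ b n, 1 ≤ n → IdentDistrib (Y b n) (Y false 1) π π
  measurePreserving : ∀ j, MeasurePreserving (θ j) π π
  swap : ∀ b n j x, n ≤ j → Y b n (θ j x) = Y (!b) n x
  summable : Summable a
  norm_sub_le : ∀ b j p, (eLpNorm (fun x => Y b (j + p + 1) x - Y b (j + p + 1) (θ j x)) 4 π).toReal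
    ≤ a p

variable [MeasurableSpace H] [BorelSpace H] [SecondCountableTopology H]
  {Ω : Type u} [MeasurableSpace Ω] {P : Measure Ω} [IsProbabilityMeasure P]

/-- Transfers the problem to the path space `Bool × ℤ → S`, where exchanging the copies up to time
`j` is a measure preserving map; on `Ω × Ω` itself no such map need exist. -/
theorem LpMApproximable.exists_isSwapApproximable {X : ℕ → Ω → H}
    (h : LpMApproximable.{u, v, w} 4 X P) :
    ∃ (E : Type w) (_ : MeasurableSpace E) (π : Measure E) (W : Ω × Ω → E)
      (Y : Bool → ℕ → E → H) (θ : ℕ → E → E) (M : ℝ) (a : ℕ → ℝ),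
      IsProbabilityMeasure π ∧ MeasurePreserving W (P.prod P) π ∧
      IsSwapApproximable π Y θ M a ∧
      (∀ n, 1 ≤ n → (fun z : Ω × Ω => X n z.1) =ᵐ[P.prod P] fun z => Y false n (W z)) ∧
      (∀ n, 1 ≤ n → (fun z : Ω × Ω => X n z.2) =ᵐ[P.prod P] fun z => Y true n (W z)) := by
  obtain ⟨hmem, S, _, δ, f, hδ, hind, hid, hf, hX, hsum⟩ := h
  have : IsProbabilityMeasure (P.map (δ 0)) := Measure.isProbabilityMeasure_map (hδ 0).aemeasurable
  set π : Measure (Bool × ℤ → S) := Measure.infinitePi fun _ => P.map (δ 0) with hπ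
  have hW : MeasurePreserving (pairPath δ) (P.prod P) π :=
    ⟨measurable_pairPath hδ, map_pairPath hδ hind hid⟩
  set Y : Bool → ℕ → (Bool × ℤ → S) → H := fun b n x => f fun k : ℕ => x (b, (n : ℤ) - k) with hY
  set θ : ℕ → (Bool × ℤ → S) → (Bool × ℤ → S) := fun j x i => x (swapIndex j i) with hθ
  have hYm : ∀ b n, Measurable (Y b n) := fun b n => hf.comp (by fun_prop)
  have hθm : ∀ j, MeasurePreserving (θ j) π π := fun j =>
    measurePreserving_reindex _ (swapIndex_injective _)
  have hX1 : ∀ n, 1 ≤ n →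
      (fun z : Ω × Ω => X n z.1) =ᵐ[P.prod P] fun z => Y false n (pairPath δ z) := fun n hn =>
    measurePreserving_fst.quasiMeasurePreserving.ae_eq_comp (hX n hn)
  have hX2 : ∀ n, 1 ≤ n →
      (fun z : Ω × Ω => X n z.2) =ᵐ[P.prod P] fun z => Y true n (pairPath δ z) := fun n hn =>
    measurePreserving_snd.quasiMeasurePreserving.ae_eq_comp (hX n hn)
  have hY1 : MemLp (Y false 1) 4 π := by
    rw [← hW.map_eq, memLp_map_measure_iff (hYm _ _).aestronglyMeasurable hW.aemeasurable]
    exact ((hmem 1 le_rfl).comp_measurePreserving measurePreserving_fst).ae_eq (hX1 1 le_rfl)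
  have hYshift : ∀ b n, 1 ≤ n →
      Y b n = Y false 1 ∘ fun x i => x (shiftIndex b ((n : ℤ) - 1) i) := by
    intro b n hn
    ext x
    simp only [hY, shiftIndex, Function.comp_apply, Bool.false_xor]
    congr 1
    ext k
    congr 2
    push_cast
    ring
  set a : ℕ → ℝ := fun m =>
    (eLpNorm (fun z : Ω × Ω => X (m + 1) z.1 - coupled f δ (m + 1) (m + 1) z) 4
      (P.prod P)).toReal with ha
  refine ⟨_, inferInstance, π, pairPath δ, Y, θ, (eLpNorm (Y false 1) 4 π).toReal, a,
    inferInstance, hW, ⟨?_, ?_, ?_, hθm, ?_, ?_, ?_⟩, hX1, hX2⟩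
  · intro b n hn
    rw [hYshift b n hn]
    exact hY1.comp_measurePreserving (measurePreserving_reindex _ (shiftIndex_injective _ _))
  · intro b n hn
    rw [hYshift b n hn, eLpNorm_comp_measurePreserving hY1.1
      (measurePreserving_reindex _ (shiftIndex_injective _ _))]
  · intro b n hn
    have hmp := measurePreserving_reindex (P.map (δ 0)) (shiftIndex_injective b ((n : ℤ) - 1))
    refine ⟨(hYm _ _).aemeasurable, (hYm _ _).aemeasurable, ?_⟩
    rw [hYshift b n hn, ← Measure.map_map (hYm _ _) hmp.measurable, hmp.map_eq]
  · intro b n j x hnj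
    simp only [hY, hθ, swapIndex]
    congr 1
    ext k
    rw [if_pos (by omega)]
  · exact ENNReal.summable_toReal hsum.ne
  · intro b j p
    -- Stationarity: shifting time by `j` reduces to a swap at time `0`, which at time `p + 1` keeps
    -- the innovations `1, …, p + 1`. This is the coupling of order `p + 1` in the definition.
    have h1 : (fun x => Y b (j + p + 1) x - Y b (j + p + 1) (θ j x)) =
        (fun x => Y false (p + 1) x - Y false (p + 1) (θ 0 x)) ∘
          fun x i => x (shiftIndex b j i) := by
      ext x
      simp only [hY, hθ, shiftIndex, swapIndex, Function.comp_apply, Bool.false_xor]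
      congr 1
      · congr 1
        ext k
        congr 2
        push_cast
        ring
      · congr 1
        ext k
        congr 2
        · by_cases hk : (p + 1 : ℤ) - k ≤ 0
          · rw [if_pos (by push_cast; omega), if_pos (by push_cast; omega)]
            simp
          · rw [if_neg (by push_cast; omega), if_neg (by push_cast; omega)]
            simp
        · push_cast
          ring
    have hm : AEStronglyMeasurable (fun x => Y false (p + 1) x - Y false (p + 1) (θ 0 x)) π :=
      ((hYm _ _).sub ((hYm _ _).comp (hθm 0).measurable)).aestronglyMeasurable
    have h2 : (fun z : Ω × Ω => X (p + 1) z.1 - coupled f δ (p + 1) (p + 1) z) =ᵐ[P.prod P]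
        (fun x => Y false (p + 1) x - Y false (p + 1) (θ 0 x)) ∘ pairPath δ := by
      filter_upwards [hX1 (p + 1) (by omega)] with z hz
      simp only [Function.comp_apply, hz]
      congr 1
      simp only [coupled, hY, hθ, swapIndex, pairPath]
      congr 1
      ext k
      by_cases hk : k < p + 1
      · rw [if_pos hk, if_neg (c := ((p + 1 : ℕ) : ℤ) - k ≤ ((0 : ℕ) : ℤ)) (by push_cast; omega)]
        simp
      · rw [if_neg hk, if_pos (c := ((p + 1 : ℕ) : ℤ) - k ≤ ((0 : ℕ) : ℤ)) (by push_cast; omega)]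
        simp
    rw [h1, eLpNorm_comp_measurePreserving hm
      (measurePreserving_reindex _ (shiftIndex_injective _ _))]
    simp only [ha]
    rw [eLpNorm_congr_ae h2, eLpNorm_comp_measurePreserving hm hW]

end Coupling

/-! ### Hölder estimates for products of four `L⁴` variables. -/

section Holder

variable {H : Type v} [NormedAddCommGroup H] [InnerProductSpace ℝ H]
  {E : Type w} [MeasurableSpace E] {π : Measure E}

instance holderTriple_four_four_two : ENNReal.HolderTriple 4 4 2 where
  inv_add_inv_eq_inv := by
    rw [← two_mul, show (4 : ℝ≥0∞) = 2 * 2 by norm_num,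
      ENNReal.mul_inv (Or.inl two_ne_zero) (Or.inl ENNReal.ofNat_ne_top), ← mul_assoc,
      ENNReal.mul_inv_cancel two_ne_zero ENNReal.ofNat_ne_top, one_mul]

theorem memLp_inner {U V : E → H} (hU : MemLp U 4 π) (hV : MemLp V 4 π) :
    MemLp (fun x => (inner ℝ (U x) (V x) : ℝ)) 2 π :=
  MemLp.of_bilin (fun a b : H => (inner ℝ a b : ℝ)) 1 hU hV (hU.1.inner hV.1)
    (ae_of_all _ fun x => by simpa using nnnorm_inner_le_nnnorm (𝕜 := ℝ) (U x) (V x))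

theorem eLpNorm_inner_le {U V : E → H} (hU : MemLp U 4 π) (hV : MemLp V 4 π) :
    eLpNorm (fun x => (inner ℝ (U x) (V x) : ℝ)) 2 π ≤ eLpNorm U 4 π * eLpNorm V 4 π := by
  simpa using eLpNorm_le_eLpNorm_mul_eLpNorm_of_nnnorm (r := 2) hU.1 hV.1
    (fun a b : H => (inner ℝ a b : ℝ)) 1
    (ae_of_all _ fun x => by simpa using nnnorm_inner_le_nnnorm (𝕜 := ℝ) (U x) (V x))

theorem integrable_inner_mul_inner {U V U' V' : E → H} (hU : MemLp U 4 π) (hV : MemLp V 4 π)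
    (hU' : MemLp U' 4 π) (hV' : MemLp V' 4 π) :
    Integrable (fun x => (inner ℝ (U x) (V x) : ℝ) * inner ℝ (U' x) (V' x)) π :=
  (memLp_inner hU hV).integrable_mul (memLp_inner hU' hV')

theorem abs_integral_inner_mul_inner_le {U V U' V' : E → H} (hU : MemLp U 4 π) (hV : MemLp V 4 π)
    (hU' : MemLp U' 4 π) (hV' : MemLp V' 4 π) :
    |∫ x, (inner ℝ (U x) (V x) : ℝ) * inner ℝ (U' x) (V' x) ∂π| ≤
      (eLpNorm U 4 π).toReal * (eLpNorm V 4 π).toReal *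
        ((eLpNorm U' 4 π).toReal * (eLpNorm V' 4 π).toReal) := by
  have h1 := eLpNorm_smul_le_mul_eLpNorm (p := 2) (q := 2) (r := 1) (memLp_inner hU' hV').1
    (memLp_inner hU hV).1
  have h2 := h1.trans (mul_le_mul' (eLpNorm_inner_le hU hV) (eLpNorm_inner_le hU' hV'))
  rw [← ENNReal.toReal_mul, ← ENNReal.toReal_mul, ← ENNReal.toReal_mul]
  rw [eLpNorm_one_eq_lintegral_enorm] at h2
  rw [← Real.norm_eq_abs]
  refine (norm_integral_le_lintegral_norm _).trans
    (ENNReal.toReal_mono (ENNReal.mul_ne_top (ENNReal.mul_ne_top hU.2.ne hV.2.ne)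
      (ENNReal.mul_ne_top hU'.2.ne hV'.2.ne)) ?_)
  exact (lintegral_congr fun x => ofReal_norm _).trans_le h2

end Holder

/-! ### Expansion of the symmetrized sum. -/

section TensorInner

variable {H : Type v} [NormedAddCommGroup H] [InnerProductSpace ℝ H] {E : Type w}

/-- The Hilbert-Schmidt inner product of two of the tensors `Y b k ⊗ B b k`. -/
noncomputable def tensorInner (Y B : Bool → ℕ → E → H) (b : Bool) (k : ℕ) (c : Bool) (l : ℕ)
    (x : E) : ℝ :=
  inner ℝ (Y b k x) (Y c l x) * inner ℝ (B b k x) (B c l x)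

theorem tensorInner_comm (Y B : Bool → ℕ → E → H) (b : Bool) (k : ℕ) (c : Bool) (l : ℕ) :
    tensorInner Y B b k c l = tensorInner Y B c l b k := by
  ext x
  rw [tensorInner, tensorInner, real_inner_comm, real_inner_comm (B b k x)]

/-- The four signed terms are paired so that each difference has a fixed factor at time `l` and both
copies at time `k`; such a difference has small expectation when `l - k` is large. -/
theorem norm_sum_tensor_sub_sq_le [CompleteSpace H] (Y B : Bool → ℕ → E → H) (n : ℕ) (x : E) :
    ‖∑ k ∈ Finset.Icc 1 n, (tensor (Y false k x) (B false k x) - tensor (Y true k x) (B true k x))‖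
      ^ 2 ≤ ∑ k ∈ Finset.Icc 1 n, ∑ l ∈ Finset.Icc 1 n,
        (tensorInner Y B false k false l x - tensorInner Y B true k false l x +
          (tensorInner Y B true k true l x - tensorInner Y B false k true l x)) := by
  set sg : Bool → ℝ := fun b => if b then -1 else 1 with hsg
  have h1 : ∑ k ∈ Finset.Icc 1 n,
      (tensor (Y false k x) (B false k x) - tensor (Y true k x) (B true k x)) =
      ∑ i ∈ Finset.Icc 1 n ×ˢ (Finset.univ : Finset Bool),
        tensor (Y i.2 i.1 x) (sg i.2 • B i.2 i.1 x) := by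
    rw [Finset.sum_product]
    refine Finset.sum_congr rfl fun k _ => ?_
    rw [Fintype.sum_bool]
    ext z
    simp only [hsg, add_apply, sub_apply, tensor_apply]
    simp
    abel
  rw [h1]
  refine (norm_sum_tensor_sq_le _ _ _).trans (le_of_eq ?_)
  rw [Finset.sum_product]
  refine Finset.sum_congr rfl fun k _ => ?_
  simp only [Finset.sum_product, Fintype.sum_bool]
  rw [← Finset.sum_add_distrib]
  refine Finset.sum_congr rfl fun l _ => ?_
  simp only [hsg, tensorInner, real_inner_smul_left, real_inner_smul_right]
  simp
  ring

end TensorInner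

/-- Each row sum is at most `2 ∑ γ`, one series for each side of the diagonal. -/
theorem sum_sum_le_of_dist_le {h : ℕ → ℕ → ℝ} {γ : ℕ → ℝ} (hγ0 : ∀ d, 0 ≤ γ d)
    (hγ : Summable γ) (hsymm : ∀ k l, h k l = h l k)
    (hle : ∀ k d, 1 ≤ k → h k (k + d) ≤ γ d) (n : ℕ) :
    ∑ k ∈ Finset.Icc 1 n, ∑ l ∈ Finset.Icc 1 n, h k l ≤ 2 * (∑' d, γ d) * n := by
  have hrow : ∀ k ∈ Finset.Icc 1 n, ∑ l ∈ Finset.Icc 1 n, h k l ≤ 2 * ∑' d, γ d := by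
    intro k hk
    have hk1 := (Finset.mem_Icc.1 hk).1
    rw [← Finset.sum_filter_add_sum_filter_not _ (fun l => k ≤ l), two_mul]
    refine add_le_add ?_ ?_
    · calc _ ≤ ∑ l ∈ (Finset.Icc 1 n).filter (fun l => k ≤ l), γ (l - k) := by
            refine Finset.sum_le_sum fun l hl => ?_
            have hkl := (Finset.mem_filter.1 hl).2
            simpa [Nat.add_sub_cancel' hkl] using hle k (l - k) hk1
        _ = ∑ d ∈ ((Finset.Icc 1 n).filter (fun l => k ≤ l)).image (fun l => l - k), γ d := by
            refine (Finset.sum_image fun l hl l' hl' hll => ?_).symm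
            have h1 := (Finset.mem_filter.1 hl).2
            have h2 := (Finset.mem_filter.1 hl').2
            omega
        _ ≤ _ := hγ.sum_le_tsum _ fun d _ => hγ0 d
    · calc _ ≤ ∑ l ∈ (Finset.Icc 1 n).filter (fun l => ¬ k ≤ l), γ (k - l) := by
            refine Finset.sum_le_sum fun l hl => ?_
            obtain ⟨hl1, hkl⟩ := Finset.mem_filter.1 hl
            rw [hsymm]
            simpa [Nat.add_sub_cancel' (not_le.1 hkl).le] using
              hle l (k - l) (Finset.mem_Icc.1 hl1).1
        _ = ∑ d ∈ ((Finset.Icc 1 n).filter (fun l => ¬ k ≤ l)).image (fun l => k - l), γ d := by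
            refine (Finset.sum_image fun l hl l' hl' hll => ?_).symm
            have h1 := (Finset.mem_filter.1 hl).2
            have h2 := (Finset.mem_filter.1 hl').2
            omega
        _ ≤ _ := hγ.sum_le_tsum _ fun d _ => hγ0 d
  refine (Finset.sum_le_sum hrow).trans ?_
  simp [mul_comm]

/-! ### Decay of correlations and the second moment bound. -/

section Covariance

variable {H : Type v} [NormedAddCommGroup H] [InnerProductSpace ℝ H]
  {E : Type w} [MeasurableSpace E] {π : Measure E}

theorem memLp_linComb {p : ℝ≥0∞} (L₁ L₂ : H →L[ℝ] H) {U V : E → H} (hU : MemLp U p π)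
    (hV : MemLp V p π) : MemLp (fun x => L₁ (U x) + L₂ (V x)) p π :=
  (L₁.comp_memLp' hU).add (L₂.comp_memLp' hV)

theorem toReal_eLpNorm_linComb_le (L₁ L₂ : H →L[ℝ] H) {U V : E → H} (hU : MemLp U 4 π)
    (hV : MemLp V 4 π) : (eLpNorm (fun x => L₁ (U x) + L₂ (V x)) 4 π).toReal ≤
      ‖L₁‖ * (eLpNorm U 4 π).toReal + ‖L₂‖ * (eLpNorm V 4 π).toReal := by
  have h1 : ∀ (L : H →L[ℝ] H) {U : E → H}, MemLp U 4 π →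
      (eLpNorm (fun x => L (U x)) 4 π).toReal ≤ ‖L‖ * (eLpNorm U 4 π).toReal := by
    intro L U hU
    have h := eLpNorm_le_mul_eLpNorm_of_ae_le_mul (f := fun x => L (U x)) (g := U) (c := ‖L‖)
      (μ := π) (ae_of_all _ fun x => L.le_opNorm _) 4
    refine (ENNReal.toReal_mono (ENNReal.mul_ne_top ENNReal.ofReal_ne_top hU.2.ne) h).trans ?_
    rw [ENNReal.toReal_mul, ENNReal.toReal_ofReal (norm_nonneg _)]
  have h2 := eLpNorm_add_le (p := 4) (L₁.comp_memLp' hU).1 (L₂.comp_memLp' hV).1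
    (by norm_num)
  refine (ENNReal.toReal_mono (ENNReal.add_ne_top.2 ⟨(L₁.comp_memLp' hU).2.ne,
    (L₂.comp_memLp' hV).2.ne⟩) h2).trans ?_
  rw [ENNReal.toReal_add (L₁.comp_memLp' hU).2.ne (L₂.comp_memLp' hV).2.ne]
  exact add_le_add (h1 L₁ hU) (h1 L₂ hV)

variable [MeasurableSpace H] {Y : Bool → ℕ → E → H} {θ : ℕ → E → E} {M : ℝ} {a : ℕ → ℝ}

theorem IsSwapApproximable.abs_integral_sub_le (h : IsSwapApproximable π Y θ M a)
    (L₁ L₂ : H →L[ℝ] H) {B : Bool → ℕ → E → H}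
    (hB : ∀ b n x, B b n x = L₁ (Y b n x) + L₂ (Y b (n + 1) x)) (b : Bool) {k : ℕ} (hk : 1 ≤ k)
    (p : ℕ) :
    |∫ x, tensorInner Y B b k b (k + (p + 2)) x ∂π -
        ∫ x, tensorInner Y B (!b) k b (k + (p + 2)) x ∂π| ≤
      M * a p * (((‖L₁‖ + ‖L₂‖) * M) * ((‖L₁‖ + ‖L₂‖) * M)) +
        M * M * (((‖L₁‖ + ‖L₂‖) * M) * (‖L₁‖ * a p + ‖L₂‖ * a (p + 1))) := by
  set l := k + (p + 2) with hl
  set β := (‖L₁‖ + ‖L₂‖) * M with hβ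
  -- The swap must reach time `k + 1`, since `B b k` involves `Y b (k + 1)`. This costs one step of
  -- the lag, hence `p + 2`.
  set τ := θ (k + 1) with hτ
  have hM0 : 0 ≤ M := ENNReal.toReal_nonneg.trans (h.norm_le false 1 le_rfl)
  have hβ0 : 0 ≤ β := by positivity
  have hBe : ∀ b n, B b n = fun x => L₁ (Y b n x) + L₂ (Y b (n + 1) x) := fun b n =>
    funext fun x => hB b n x
  have hY4 : ∀ n, 1 ≤ n → MemLp (Y b n) 4 π := h.memLp b
  have hB4 : ∀ n, 1 ≤ n → MemLp (B b n) 4 π := fun n hn => by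
    rw [hBe]
    exact memLp_linComb L₁ L₂ (hY4 n hn) (hY4 (n + 1) (by omega))
  have hYM : ∀ n, 1 ≤ n → (eLpNorm (Y b n) 4 π).toReal ≤ M := h.norm_le b
  have hBM : ∀ n, 1 ≤ n → (eLpNorm (B b n) 4 π).toReal ≤ β := fun n hn => by
    rw [hBe, hβ, add_mul]
    refine (toReal_eLpNorm_linComb_le L₁ L₂ (hY4 n hn) (hY4 (n + 1) (by omega))).trans ?_
    gcongr
    exacts [hYM n hn, hYM (n + 1) (by omega)]
  have hτm : MeasurePreserving τ π π := h.measurePreserving _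
  have hYτ : ∀ n, 1 ≤ n → MemLp (fun x => Y b n (τ x)) 4 π := fun n hn =>
    (hY4 n hn).comp_measurePreserving hτm
  have hBτ : ∀ n, 1 ≤ n → MemLp (fun x => B b n (τ x)) 4 π := fun n hn =>
    (hB4 n hn).comp_measurePreserving hτm
  have hYτM : ∀ n, 1 ≤ n → (eLpNorm (fun x => Y b n (τ x)) 4 π).toReal ≤ M := fun n hn => by
    have := eLpNorm_comp_measurePreserving (p := 4) (hY4 n hn).1 hτm
    rw [Function.comp_def] at this
    rw [this]
    exact hYM n hn
  have hYd : (eLpNorm (fun x => Y b l x - Y b l (τ x)) 4 π).toReal ≤ a p := by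
    have := h.norm_sub_le b (k + 1) p
    rwa [show k + 1 + p + 1 = l by omega] at this
  have hYd' : (eLpNorm (fun x => Y b (l + 1) x - Y b (l + 1) (τ x)) 4 π).toReal ≤ a (p + 1) := by
    have := h.norm_sub_le b (k + 1) (p + 1)
    rwa [show k + 1 + (p + 1) + 1 = l + 1 by omega] at this
  have hBd : (eLpNorm (fun x => B b l x - B b l (τ x)) 4 π).toReal ≤
      ‖L₁‖ * a p + ‖L₂‖ * a (p + 1) := by
    have he : (fun x => B b l x - B b l (τ x)) = fun x =>
        L₁ (Y b l x - Y b l (τ x)) + L₂ (Y b (l + 1) x - Y b (l + 1) (τ x)) := by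
      ext x
      rw [hB, hB, map_sub, map_sub]
      abel
    rw [he]
    refine (toReal_eLpNorm_linComb_le L₁ L₂ ((hY4 l (by omega)).sub (hYτ l (by omega)))
      ((hY4 (l + 1) (by omega)).sub (hYτ (l + 1) (by omega)))).trans ?_
    gcongr
    exacts [hYd, hYd']
  -- Composing with `τ` keeps the integral and flips the copy in the factors at time `k`, leaving
  -- the factors at time `l` perturbed.
  have hswap : ∫ x, tensorInner Y B (!b) k b l x ∂π =
      ∫ x, (inner ℝ (Y b k x) (Y b l (τ x)) : ℝ) * inner ℝ (B b k x) (B b l (τ x)) ∂π := by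
    have hmeas : AEStronglyMeasurable (tensorInner Y B (!b) k b l) π := by
      refine ((h.memLp _ k hk).1.inner (hY4 l (by omega)).1).mul (AEStronglyMeasurable.inner ?_
        (hB4 l (by omega)).1)
      rw [hBe]
      exact (memLp_linComb L₁ L₂ (h.memLp _ k hk) (h.memLp _ (k + 1) (by omega))).1
    rw [← hτm.map_eq] at hmeas
    conv_lhs => rw [← hτm.map_eq, integral_map hτm.aemeasurable hmeas]
    refine integral_congr_ae (ae_of_all _ fun x => ?_)
    simp only [tensorInner]
    rw [hB (!b) k, hτ, h.swap _ _ _ _ (Nat.le_succ k), h.swap _ _ _ _ le_rfl, Bool.not_not,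
      ← hB]
  have hi1 := integrable_inner_mul_inner (hY4 k hk) (hY4 l (by omega)) (hB4 k hk)
    (hB4 l (by omega))
  have hi2 := integrable_inner_mul_inner (hY4 k hk) (hYτ l (by omega)) (hB4 k hk)
    (hBτ l (by omega))
  have hi3 := integrable_inner_mul_inner (hY4 k hk) ((hY4 l (by omega)).sub (hYτ l (by omega)))
    (hB4 k hk) (hB4 l (by omega))
  have hi4 := integrable_inner_mul_inner (hY4 k hk) (hYτ l (by omega))
    (hB4 k hk) ((hB4 l (by omega)).sub (hBτ l (by omega)))
  have hsplit : ∫ x, tensorInner Y B b k b l x ∂π - ∫ x, tensorInner Y B (!b) k b l x ∂π =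
      ∫ x, (inner ℝ (Y b k x) (Y b l x - Y b l (τ x)) : ℝ) * inner ℝ (B b k x) (B b l x) ∂π +
      ∫ x, (inner ℝ (Y b k x) (Y b l (τ x)) : ℝ) *
        inner ℝ (B b k x) (B b l x - B b l (τ x)) ∂π := by
    rw [hswap]
    simp only [tensorInner]
    rw [← integral_sub hi1 hi2]
    refine Eq.trans ?_ (integral_add hi3 hi4)
    refine integral_congr_ae (ae_of_all _ fun x => ?_)
    simp only [inner_sub_right]
    ring
  rw [hsplit]
  have hap : 0 ≤ a p := ENNReal.toReal_nonneg.trans hYd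
  refine (abs_add_le _ _).trans (add_le_add ?_ ?_)
  · refine (abs_integral_inner_mul_inner_le (hY4 k hk) ((hY4 l (by omega)).sub
      (hYτ l (by omega))) (hB4 k hk) (hB4 l (by omega))).trans ?_
    gcongr
    exacts [hYM k hk, hYd, hBM k hk, hBM l (by omega)]
  · refine (abs_integral_inner_mul_inner_le (hY4 k hk) (hYτ l (by omega)) (hB4 k hk)
      ((hB4 l (by omega)).sub (hBτ l (by omega)))).trans ?_
    gcongr
    exacts [hYM k hk, hYτM l (by omega), hBM k hk, hBd]

/-- The second moment of the symmetrized sum of tensors grows at most linearly. -/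
theorem IsSwapApproximable.exists_integral_norm_sq_le [CompleteSpace H]
    (h : IsSwapApproximable π Y θ M a)
    (L₁ L₂ : H →L[ℝ] H) {B : Bool → ℕ → E → H}
    (hB : ∀ b n x, B b n x = L₁ (Y b n x) + L₂ (Y b (n + 1) x)) :
    ∃ c : ℝ, ∀ n : ℕ, ∫ x, ‖∑ k ∈ Finset.Icc 1 n,
      (tensor (Y false k x) (B false k x) - tensor (Y true k x) (B true k x))‖ ^ 2 ∂π ≤ c * n := by
  set β := (‖L₁‖ + ‖L₂‖) * M with hβ
  have hM0 : 0 ≤ M := ENNReal.toReal_nonneg.trans (h.norm_le false 1 le_rfl)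
  have hβ0 : 0 ≤ β := by positivity
  have ha0 : ∀ p, 0 ≤ a p := fun p => ENNReal.toReal_nonneg.trans (h.norm_sub_le false 0 p)
  have hB4 : ∀ b n, 1 ≤ n → MemLp (B b n) 4 π := fun b n hn => by
    rw [show B b n = fun x => L₁ (Y b n x) + L₂ (Y b (n + 1) x) from funext fun x => hB b n x]
    exact memLp_linComb L₁ L₂ (h.memLp b n hn) (h.memLp b (n + 1) (by omega))
  have hBM : ∀ b n, 1 ≤ n → (eLpNorm (B b n) 4 π).toReal ≤ β := fun b n hn => by
    rw [show B b n = fun x => L₁ (Y b n x) + L₂ (Y b (n + 1) x) from funext fun x => hB b n x,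
      hβ, add_mul]
    refine (toReal_eLpNorm_linComb_le L₁ L₂ (h.memLp b n hn)
      (h.memLp b (n + 1) (by omega))).trans ?_
    gcongr
    exacts [h.norm_le b n hn, h.norm_le b (n + 1) (by omega)]
  have hint : ∀ b k c l, 1 ≤ k → 1 ≤ l → Integrable (tensorInner Y B b k c l) π :=
    fun b k c l hk hl => integrable_inner_mul_inner (h.memLp b k hk) (h.memLp c l hl)
      (hB4 b k hk) (hB4 c l hl)
  set r : ℕ → ℝ := fun p => M * a p * (β * β) + M * M * (β * (‖L₁‖ * a p + ‖L₂‖ * a (p + 1)))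
    with hr
  set g : ℕ → ℕ → ℝ := fun k l =>
    (∫ x, tensorInner Y B false k false l x ∂π - ∫ x, tensorInner Y B true k false l x ∂π) +
    (∫ x, tensorInner Y B true k true l x ∂π - ∫ x, tensorInner Y B false k true l x ∂π) with hg
  -- Lags `0` and `1` are too short for the swap argument and get the plain Hölder bound.
  set γ : ℕ → ℝ := fun d => if d < 2 then 4 * (M * M * (β * β)) else 2 * r (d - 2) with hγ
  have hr0 : ∀ p, 0 ≤ r p := fun p => by
    have := ha0 p
    have := ha0 (p + 1)
    positivity
  have hrs : Summable r :=
    ((h.summable.mul_left M).mul_right _).add (((((h.summable.mul_left ‖L₁‖).add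
      (((summable_nat_add_iff 1).2 h.summable).mul_left ‖L₂‖))).mul_left β).mul_left (M * M))
  have hγ0 : ∀ d, 0 ≤ γ d := fun d => by
    simp only [hγ]
    split_ifs
    · positivity
    · exact mul_nonneg zero_le_two (hr0 _)
  have hγs : Summable γ := by
    rw [← summable_nat_add_iff 2]
    simpa [hγ] using hrs.mul_left 2
  have hsymm : ∀ k l, g k l = g l k := fun k l => by
    simp only [hg]
    rw [tensorInner_comm Y B false k false l, tensorInner_comm Y B true k false l,
      tensorInner_comm Y B true k true l, tensorInner_comm Y B false k true l]
    ring
  have htriv : ∀ b k c l, 1 ≤ k → 1 ≤ l →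
      |∫ x, tensorInner Y B b k c l x ∂π| ≤ M * M * (β * β) := by
    intro b k c l hk hl
    refine (abs_integral_inner_mul_inner_le (h.memLp b k hk) (h.memLp c l hl)
      (hB4 b k hk) (hB4 c l hl)).trans ?_
    gcongr
    exacts [h.norm_le b k hk, h.norm_le c l hl, hBM b k hk, hBM c l hl]
  have hle : ∀ k d, 1 ≤ k → g k (k + d) ≤ γ d := by
    intro k d hk
    by_cases hd : d < 2
    · simp only [hγ, if_pos hd, hg]
      have hl : 1 ≤ k + d := by omega
      linarith [abs_le.1 (htriv false k false (k + d) hk hl),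
        abs_le.1 (htriv true k false (k + d) hk hl),
        abs_le.1 (htriv true k true (k + d) hk hl),
        abs_le.1 (htriv false k true (k + d) hk hl)]
    · obtain ⟨p, rfl⟩ : ∃ p, d = p + 2 := ⟨d - 2, by omega⟩
      simp only [hγ, if_neg hd, hg]
      have h1 := (abs_le.1 (h.abs_integral_sub_le L₁ L₂ hB false hk p)).2
      have h2 := (abs_le.1 (h.abs_integral_sub_le L₁ L₂ hB true hk p)).2
      rw [Nat.add_sub_cancel, two_mul]
      exact add_le_add h1 h2
  refine ⟨2 * ∑' d, γ d, fun n => le_trans ?_ (sum_sum_le_of_dist_le hγ0 hγs hsymm hle n)⟩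
  have hterm : ∀ k ∈ Finset.Icc 1 n, ∀ l ∈ Finset.Icc 1 n, Integrable (fun x =>
      tensorInner Y B false k false l x - tensorInner Y B true k false l x +
        (tensorInner Y B true k true l x - tensorInner Y B false k true l x)) π := by
    intro k hk l hl
    have hk1 := (Finset.mem_Icc.1 hk).1
    have hl1 := (Finset.mem_Icc.1 hl).1
    exact ((hint _ _ _ _ hk1 hl1).sub (hint _ _ _ _ hk1 hl1)).add
      ((hint _ _ _ _ hk1 hl1).sub (hint _ _ _ _ hk1 hl1))
  refine (integral_mono_of_nonneg (ae_of_all _ fun x => sq_nonneg _)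
    (integrable_finsetSum _ fun k hk => integrable_finsetSum _ fun l hl => hterm k hk l hl)
    (ae_of_all _ fun x => norm_sum_tensor_sub_sq_le Y B n x)).trans (le_of_eq ?_)
  rw [integral_finsetSum _ fun k hk => integrable_finsetSum _ fun l hl => hterm k hk l hl]
  refine Finset.sum_congr rfl fun k hk => ?_
  rw [integral_finsetSum _ fun l hl => hterm k hk l hl]
  refine Finset.sum_congr rfl fun l hl => ?_
  have hk1 := (Finset.mem_Icc.1 hk).1
  have hl1 := (Finset.mem_Icc.1 hl).1
  exact (integral_add ((hint _ _ _ _ hk1 hl1).sub (hint _ _ _ _ hk1 hl1))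
    ((hint _ _ _ _ hk1 hl1).sub (hint _ _ _ _ hk1 hl1))).trans
    (congrArg₂ (· + ·) (integral_sub (hint _ _ _ _ hk1 hl1) (hint _ _ _ _ hk1 hl1))
      (integral_sub (hint _ _ _ _ hk1 hl1) (hint _ _ _ _ hk1 hl1)))

end Covariance

/-! ### Symmetrization and the `L¹` rate. -/

section LawOfLargeNumbers

/-- The mean is the integral over an independent copy, which is then moved outside the norm. This
holds in any Banach space. -/
theorem integral_norm_sub_integral_le {Ω : Type*} [MeasurableSpace Ω] {P : Measure Ω}
    [IsProbabilityMeasure P] {G : Type*} [NormedAddCommGroup G] [NormedSpace ℝ G] [CompleteSpace G]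
    {F : Ω → G} (hF : Integrable F P) :
    ∫ ω, ‖F ω - ∫ ω', F ω' ∂P‖ ∂P ≤ ∫ z : Ω × Ω, ‖F z.1 - F z.2‖ ∂(P.prod P) := by
  have hi : Integrable (fun z : Ω × Ω => F z.1 - F z.2) (P.prod P) :=
    (hF.comp_fst P).sub (hF.comp_snd P)
  rw [integral_prod _ hi.norm]
  refine integral_mono (hF.sub (integrable_const _)).norm hi.norm.integral_prod_left fun ω => ?_
  have h1 : F ω - ∫ ω', F ω' ∂P = ∫ ω', (F ω - F ω') ∂P := by
    rw [integral_sub (integrable_const _) hF]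
    simp
  simp only [h1]
  exact norm_integral_le_integral_norm _

variable {H : Type v} [NormedAddCommGroup H] [InnerProductSpace ℝ H]
  {Ω : Type u} [MeasurableSpace Ω] {P : Measure Ω}

theorem norm_tensor (x y : H) : ‖tensor x y‖ = ‖x‖ * ‖y‖ := by
  rw [tensor, InnerProductSpace.norm_rankOne, mul_comm]

theorem continuous_tensor : Continuous fun p : H × H => tensor p.1 p.2 := by
  have h : (fun p : H × H => tensor p.1 p.2) = fun p =>
      ContinuousLinearMap.smulRightL ℝ H H (innerSL ℝ p.1) p.2 := rfl
  rw [h]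
  fun_prop

theorem memLp_tensor {U V : Ω → H} (hU : MemLp U 4 P) (hV : MemLp V 4 P) :
    MemLp (fun ω => tensor (U ω) (V ω)) 2 P := by
  have h : MemLp (fun ω => ‖U ω‖ * ‖V ω‖) 2 P :=
    MemLp.mul' (p := 4) (q := 4) (r := 2) hV.norm hU.norm
  have hm := (continuous_tensor (H := H)).comp_aestronglyMeasurable (hU.1.prodMk hV.1)
  refine h.mono hm (ae_of_all _ fun ω => ?_)
  rw [norm_tensor]
  exact le_abs_self _

variable [MeasurableSpace H] [BorelSpace H] [SecondCountableTopology H]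
  [IsProbabilityMeasure P]

theorem LpMApproximable.integral_tensor_self_eq {X : ℕ → Ω → H}
    (h : LpMApproximable.{u, v, w} 4 X P) {k : ℕ} (hk : 1 ≤ k) :
    ∫ ω, tensor (X k ω) (X k ω) ∂P = ∫ ω, tensor (X 1 ω) (X 1 ω) ∂P := by
  have hid : IdentDistrib (X k) (X 1) P P := by
    obtain ⟨E, _, π, W, Y, θ, M, a, _, hW, hY, hX, -⟩ := h.exists_isSwapApproximable
    have hlaw : ∀ n, 1 ≤ n → P.map (X n) = π.map (Y false n) := fun n hn => by
      have hYm := (hY.identDistrib false n hn).aemeasurable_fst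
      have hXm := (h.1 n hn).1.aemeasurable
      have hfst : (P.prod P).map Prod.fst = P := measurePreserving_fst.map_eq
      calc P.map (X n) = ((P.prod P).map Prod.fst).map (X n) := by rw [hfst]
        _ = (P.prod P).map (fun z => X n z.1) :=
          AEMeasurable.map_map_of_aemeasurable (by rwa [hfst]) measurable_fst.aemeasurable
        _ = (P.prod P).map (fun z => Y false n (W z)) := Measure.map_congr (hX n hn)
        _ = ((P.prod P).map W).map (Y false n) :=
          (AEMeasurable.map_map_of_aemeasurable (by rwa [hW.map_eq]) hW.aemeasurable).symm
        _ = π.map (Y false n) := by rw [hW.map_eq]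
    refine ⟨(h.1 k hk).1.aemeasurable, (h.1 1 le_rfl).1.aemeasurable, ?_⟩
    rw [hlaw k hk, hlaw 1 le_rfl, (hY.identDistrib false k hk).map_eq]
  have hc : Continuous fun x : H => tensor x x :=
    continuous_tensor.comp (continuous_id.prodMk continuous_id)
  exact (hid.comp hc.measurable).integral_eq

set_option maxHeartbeats 1600000 in
/-- The empirical cross covariance operators of an approximable sequence and a linear function of
it converge in `L¹` at rate `n^{-1/2}`. -/
theorem LpMApproximable.exists_integral_norm_sub_le [CompleteSpace H] {X : ℕ → Ω → H}
    (h : LpMApproximable.{u, v, w} 4 X P) (L₁ L₂ : H →L[ℝ] H) {B : ℕ → Ω → H}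
    (hB : ∀ k ω, B k ω = L₁ (X k ω) + L₂ (X (k + 1) ω)) {D : H →L[ℝ] H}
    (hD : ∀ k, 1 ≤ k → ∫ ω, tensor (X k ω) (B k ω) ∂P = D) :
    ∃ c : ℝ, ∀ n : ℕ, 1 ≤ n → Integrable (fun ω => ‖empiricalCross X B n ω - D‖) P ∧
      ∫ ω, ‖empiricalCross X B n ω - D‖ ∂P ≤ c / √n := by
  obtain ⟨E, _, π, W, Y, θ, M, a, _, hW, hY, hX1, hX2⟩ := h.exists_isSwapApproximable
  set BY : Bool → ℕ → E → H := fun b n x => L₁ (Y b n x) + L₂ (Y b (n + 1) x) with hBY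
  obtain ⟨c, hc⟩ := hY.exists_integral_norm_sq_le L₁ L₂ (B := BY) fun _ _ _ => rfl
  have hB4 : ∀ k, 1 ≤ k → MemLp (B k) 4 P := fun k hk => by
    rw [show B k = fun ω => L₁ (X k ω) + L₂ (X (k + 1) ω) from funext fun ω => hB k ω]
    exact memLp_linComb L₁ L₂ (h.1 k hk) (h.1 (k + 1) (by omega))
  have hBY4 : ∀ b k, 1 ≤ k → MemLp (BY b k) 4 π := fun b k hk =>
    memLp_linComb L₁ L₂ (hY.memLp b k hk) (hY.memLp b (k + 1) (by omega))
  have hint : ∀ k, 1 ≤ k → Integrable (fun ω => tensor (X k ω) (B k ω)) P := fun k hk =>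
    (memLp_tensor (h.1 k hk) (hB4 k hk)).integrable one_le_two
  refine ⟨(c + 1) / 2, fun n hn => ?_⟩
  have hn0 : (0 : ℝ) < n := by exact_mod_cast hn
  have hF : Integrable (empiricalCross X B n) P := by
    have hsum : Integrable (fun ω => ∑ k ∈ Finset.Icc 1 n, tensor (X k ω) (B k ω)) P :=
      integrable_finsetSum (Finset.Icc 1 n) (f := fun k ω => tensor (X k ω) (B k ω))
        fun k hk => hint k (Finset.mem_Icc.1 hk).1
    refine (hsum.smul (n : ℝ)⁻¹).congr (ae_of_all _ fun ω => ?_)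
    rw [empiricalCross, Pi.smul_apply]
  have hFD : ∫ ω, empiricalCross X B n ω ∂P = D := by
    simp only [empiricalCross]
    rw [integral_smul, integral_finsetSum _ fun k hk => hint k (Finset.mem_Icc.1 hk).1,
      Finset.sum_congr rfl fun k hk => hD k (Finset.mem_Icc.1 hk).1, Finset.sum_const,
      Nat.card_Icc, Nat.add_sub_cancel, ← Nat.cast_smul_eq_nsmul ℝ, smul_smul,
      inv_mul_cancel₀ hn0.ne', one_smul]
  refine ⟨(hF.sub (integrable_const D)).norm, ?_⟩
  set SY : E → H →L[ℝ] H := fun x => ∑ k ∈ Finset.Icc 1 n,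
    (tensor (Y false k x) (BY false k x) - tensor (Y true k x) (BY true k x)) with hSY
  have hSY2 : MemLp SY 2 π := memLp_finsetSum _ fun k hk =>
    (memLp_tensor (hY.memLp _ k (Finset.mem_Icc.1 hk).1) (hBY4 _ k (Finset.mem_Icc.1 hk).1)).sub
    (memLp_tensor (hY.memLp _ k (Finset.mem_Icc.1 hk).1) (hBY4 _ k (Finset.mem_Icc.1 hk).1))
  have hae : (fun z : Ω × Ω => ‖empiricalCross X B n z.1 - empiricalCross X B n z.2‖)
      =ᵐ[P.prod P] fun z => (n : ℝ)⁻¹ * ‖SY (W z)‖ := by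
    have h1 : ∀ᵐ z ∂(P.prod P), ∀ k, 1 ≤ k →
        X k z.1 = Y false k (W z) ∧ X k z.2 = Y true k (W z) := by
      rw [ae_all_iff]
      intro k
      by_cases hk : 1 ≤ k
      · filter_upwards [hX1 k hk, hX2 k hk] with z h1 h2 _ using ⟨h1, h2⟩
      · exact ae_of_all _ fun z hk' => absurd hk' hk
    filter_upwards [h1] with z hz
    rw [empiricalCross, empiricalCross, ← smul_sub, ← Finset.sum_sub_distrib, norm_smul,
      Real.norm_of_nonneg (by positivity)]
    congr 2
    refine Finset.sum_congr rfl fun k hk => ?_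
    have hk1 := (Finset.mem_Icc.1 hk).1
    rw [hB, hB, (hz k hk1).1, (hz k hk1).2, (hz (k + 1) (by omega)).1, (hz (k + 1) (by omega)).2]
  have hmean : ∫ x, ‖SY x‖ ∂π ≤ (c + 1) / 2 * √n := by
    have hs : 0 < √(n : ℝ) := Real.sqrt_pos.2 hn0
    have hss : √(n : ℝ) * √n = n := Real.mul_self_sqrt hn0.le
    have hsq : Integrable (fun x => ‖SY x‖ ^ 2) π := hSY2.integrable_norm_pow two_ne_zero
    -- The inequality `s ≤ s² / (2√n) + √n / 2` balances the second moment bound `c * n`, whence `(c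
    -- + 1) / 2`.
    calc ∫ x, ‖SY x‖ ∂π ≤ ∫ x, ((2 * √n)⁻¹ * ‖SY x‖ ^ 2 + √n / 2) ∂π := by
          refine integral_mono (hSY2.integrable one_le_two).norm
            ((hsq.const_mul _).add (integrable_const _)) fun x => ?_
          have : (2 * √n)⁻¹ * ‖SY x‖ ^ 2 + √n / 2 - ‖SY x‖ =
              (2 * √n)⁻¹ * (‖SY x‖ - √n) ^ 2 := by
            field_simp
            ring
          have h0 : 0 ≤ (2 * √n)⁻¹ * (‖SY x‖ - √n) ^ 2 := by positivity
          simp only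
          linarith
      _ = (2 * √n)⁻¹ * ∫ x, ‖SY x‖ ^ 2 ∂π + √n / 2 := by
          rw [integral_add (hsq.const_mul _) (integrable_const _), integral_const_mul]
          simp
      _ ≤ (2 * √n)⁻¹ * (c * (√n * √n)) + √n / 2 := by
          rw [hss]
          gcongr
          exact hc n
      _ = _ := by
          field_simp
  calc _ = ∫ ω, ‖empiricalCross X B n ω - ∫ ω', empiricalCross X B n ω' ∂P‖ ∂P := by rw [hFD]
    _ ≤ ∫ z : Ω × Ω, ‖empiricalCross X B n z.1 - empiricalCross X B n z.2‖ ∂(P.prod P) :=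
      integral_norm_sub_integral_le hF
    _ = ∫ z, (n : ℝ)⁻¹ * ‖SY (W z)‖ ∂(P.prod P) := integral_congr_ae hae
    _ = (n : ℝ)⁻¹ * ∫ x, ‖SY x‖ ∂π := by
      rw [integral_const_mul, ← hW.map_eq, integral_map hW.aemeasurable]
      rw [hW.map_eq]
      exact hSY2.1.norm
    _ ≤ (n : ℝ)⁻¹ * ((c + 1) / 2 * √n) := by gcongr
    _ = _ := by
      have hs : 0 < √(n : ℝ) := Real.sqrt_pos.2 hn0
      nth_rw 1 [← Real.mul_self_sqrt hn0.le]
      field_simp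

end LawOfLargeNumbers

/-! ### Symmetry and positivity of the covariance operator. -/

section Covariance

variable {H : Type v} [NormedAddCommGroup H] [InnerProductSpace ℝ H] [CompleteSpace H]
  {Ω : Type u} [MeasurableSpace Ω] {P : Measure Ω}

theorem inner_integral_tensor {U V : Ω → H}
    (h : Integrable (fun ω => tensor (U ω) (V ω)) P) (x y : H) :
    (inner ℝ ((∫ ω, tensor (U ω) (V ω) ∂P) x) y : ℝ) =
      ∫ ω, (inner ℝ (U ω) x : ℝ) * inner ℝ (V ω) y ∂P := by
  rw [ContinuousLinearMap.integral_apply h, real_inner_comm,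
    ← integral_inner (h.apply_continuousLinearMap x)]
  refine integral_congr_ae (ae_of_all _ fun ω => ?_)
  simp only [tensor_apply, real_inner_smul_right]
  rw [real_inner_comm y]

theorem inner_integral_tensor_self_left {U : Ω → H}
    (h : Integrable (fun ω => tensor (U ω) (U ω)) P) (x y : H) :
    (inner ℝ ((∫ ω, tensor (U ω) (U ω) ∂P) x) y : ℝ) =
      inner ℝ x ((∫ ω, tensor (U ω) (U ω) ∂P) y) := by
  rw [real_inner_comm _ x, inner_integral_tensor h, inner_integral_tensor h]
  simp only [mul_comm]

theorem inner_integral_tensor_self_nonneg {U : Ω → H}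
    (h : Integrable (fun ω => tensor (U ω) (U ω)) P) (x : H) :
    0 ≤ (inner ℝ ((∫ ω, tensor (U ω) (U ω) ∂P) x) x : ℝ) := by
  rw [inner_integral_tensor h]
  exact integral_nonneg fun ω => mul_self_nonneg _

end Covariance

/-! ### Growth of the threshold and Markov's inequality. -/

section Threshold

/-- Once `m n ≥ 1`, `m n / √n ≤ √(m n ^ 6 / n)`. -/
theorem tendsto_div_sqrt_of_pow_six {m : ℕ → ℝ} (hm : Tendsto m atTop atTop)
    (hm6 : (fun n => m n ^ 6) =o[atTop] (fun n : ℕ => (n : ℝ))) :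
    Tendsto (fun n => m n / √n) atTop (𝓝 0) := by
  have h1 := hm6.tendsto_div_nhds_zero.sqrt
  rw [Real.sqrt_zero] at h1
  refine squeeze_zero' ?_ ?_ h1
  · filter_upwards [hm.eventually_ge_atTop 1] with n hn
    positivity
  · filter_upwards [hm.eventually_ge_atTop 1] with n hn
    rw [Real.sqrt_div (by positivity)]
    gcongr
    refine Real.le_sqrt_of_sq_le (pow_le_pow_right₀ hn (by norm_num))

theorem measure_le_ofReal_div {Ω : Type*} [MeasurableSpace Ω] {P : Measure Ω}
    [IsProbabilityMeasure P] {f : Ω → ℝ} (hf : Integrable f P) (h0 : ∀ ω, 0 ≤ f ω) {δ : ℝ}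
    (hδ : 0 < δ) {K : ℝ} (hK : ∫ ω, f ω ∂P ≤ K) : P {ω | δ ≤ f ω} ≤ ENNReal.ofReal (K / δ) := by
  have h := mul_meas_ge_le_integral_of_nonneg (ae_of_all _ h0) hf δ
  rw [← ENNReal.ofReal_toReal (measure_ne_top P {ω | δ ≤ f ω})]
  refine ENNReal.ofReal_le_ofReal ((le_div_iff₀ hδ).2 ?_)
  rw [mul_comm]
  exact h.trans hK

end Threshold


end HilbertRegression

/-! ### The consistency theorem. -/

theorem corollary2
    {Ω : Type u} [MeasurableSpace Ω] (P : Measure Ω) [IsProbabilityMeasure P]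
    {H : Type v} [NormedAddCommGroup H] [InnerProductSpace ℝ H] [CompleteSpace H]
    [TopologicalSpace.SeparableSpace H] [MeasurableSpace H] [BorelSpace H]
    (hdim : ¬ FiniteDimensional ℝ H)
    (Ψ : H →L[ℝ] H) (X ε : ℕ → Ω → H)
    -- the ARH(1) process, with Hilbert-Schmidt norm of `Ψ` less than one
    (hARH : IsARH1 Ψ X ε P)
    (hΨ : hilbertSchmidtNorm Ψ < 1)
    -- assumption (A) for the regression of `Y_k = X_{k+1}` on `X_k`, with errors `ε_{k+1}`;
    -- it contains that the innovations are white noise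
    (hA : AssumptionA.{u, v, v, w₁, w₂} X (fun k => ε (k + 1)) P)
    -- the covariance operator of `X_1` has full rank, and distinct eigenvalues `lam j`
    (hrank : DenseRange (covOperator (X 1) P))
    (lam : ℕ → ℝ) (v : ℕ → H) (hC : IsEigensystem (covOperator (X 1) P) lam v)
    (hdistinct : Function.Injective lam)
    -- any choice of eigenvalues and eigenvectors of the empirical covariance operators
    (lamHat : ℕ → Ω → ℕ → ℝ) (vHat : ℕ → Ω → ℕ → H)
    (hHat : ∀ n ω, IsEigensystem (empiricalCross X X n ω) (lamHat n ω) (vHat n ω))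
    -- assumption (K): `m_n → ∞` and `m_n ^ 6 = o(n)`
    (m : ℕ → ℝ) (hm : Tendsto m atTop atTop)
    (hm6 : (fun n => m n ^ 6) =o[atTop] (fun n : ℕ => (n : ℝ))) :
    TendstoInMeasure P
      (fun n ω => pcEstimator (empiricalCross X (fun k => X (k + 1)) n ω) (lamHat n ω) (vHat n ω)
        (truncationLevel (lamHat n ω) (m n)))
      atTop (fun _ => Ψ) := by
  have : SecondCountableTopology H := UniformSpace.secondCountable_of_separable H
  have hX := hA.approximable_X
  have hX1 : Integrable (fun ω => tensor (X 1 ω) (X 1 ω)) P :=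
    (memLp_tensor (hX.1 1 le_rfl) (hX.1 1 le_rfl)).integrable one_le_two
  have hcov : covOperator (X 1) P = ∫ ω, tensor (X 1 ω) (X 1 ω) ∂P := by
    simp [covOperator, hA.mean_X 1 le_rfl]
  set C := covOperator (X 1) P with hCdef
  -- Using `X (k + 1) - Ψ (X k)` in place of `ε (k + 1)` makes the decomposition exact for every `ω`
  -- and the noise linear in `X`.
  set R : ℕ → Ω → H := fun k ω => (-Ψ) (X k ω) + ContinuousLinearMap.id ℝ H (X (k + 1) ω) with hR
  have hRε : ∀ k, 1 ≤ k → ∫ ω, tensor (X k ω) (R k ω) ∂P = 0 := by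
    intro k hk
    rw [← hA.orthogonal k hk]
    refine integral_congr_ae ?_
    filter_upwards [hARH k hk] with ω hω
    simp [hR, hω]
  obtain ⟨c₁, hc₁⟩ := hX.exists_integral_norm_sub_le (ContinuousLinearMap.id ℝ H) 0 (B := X)
    (fun k ω => by simp) (D := C) fun k hk => by rw [hX.integral_tensor_self_eq hk, hcov]
  obtain ⟨c₂, hc₂⟩ := hX.exists_integral_norm_sub_le (-Ψ) (ContinuousLinearMap.id ℝ H) (B := R)
    (fun k ω => rfl) hRε
  have hdecomp : ∀ n ω, empiricalCross X (fun k => X (k + 1)) n ω =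
      Ψ ∘L empiricalCross X X n ω + empiricalCross X R n ω := by
    intro n ω
    ext z
    simp only [add_apply, ContinuousLinearMap.comp_apply, empiricalCross_apply, map_smul, map_sum,
      ← smul_add, ← Finset.sum_add_distrib]
    simp [hR]
  rw [tendstoInMeasure_iff_norm]
  intro η hη
  obtain ⟨δ, hδ, M, hM⟩ := hC.exists_bias_le
    (fun x y => by rw [hcov]; exact inner_integral_tensor_self_left hX1 x y)
    (fun x => by rw [hcov]; exact inner_integral_tensor_self_nonneg hX1 x) hrank hdistinct
    (hΨ.trans ENNReal.one_lt_top) (η := η / 3) (by positivity)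
  have hlim : Tendsto (fun n : ℕ => ENNReal.ofReal (c₁ / √n / δ) +
      ENNReal.ofReal (m n * (c₂ / √n) / (η / 3))) atTop (𝓝 0) := by
    have hs : Tendsto (fun n : ℕ => √(n : ℝ)) atTop atTop :=
      Real.tendsto_sqrt_atTop.comp tendsto_natCast_atTop_atTop
    have h1 : Tendsto (fun n : ℕ => c₁ / √n / δ) atTop (𝓝 0) := by
      simpa using (hs.const_div_atTop c₁).div_const δ
    have h2 : Tendsto (fun n : ℕ => m n * (c₂ / √n) / (η / 3)) atTop (𝓝 0) := by
      have h3 := ((tendsto_div_sqrt_of_pow_six hm hm6).const_mul c₂).div_const (η / 3)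
      rw [mul_zero, zero_div] at h3
      refine h3.congr fun n => ?_
      ring
    simpa using (ENNReal.tendsto_ofReal h1).add (ENNReal.tendsto_ofReal h2)
  refine tendsto_of_tendsto_of_tendsto_of_le_of_le' tendsto_const_nhds hlim
    (Eventually.of_forall fun _ => zero_le) ?_
  filter_upwards [hm.eventually_ge_atTop M, hm.eventually_ge_atTop 0, eventually_ge_atTop 1]
    with n hMn hm0 hn
  -- Off both events the bias is at most `η / 3` and the noise less than `η / 3`, so the total stays
  -- below `η`.
  have hsub : {ω | η ≤ ‖pcEstimator (empiricalCross X (fun k => X (k + 1)) n ω) (lamHat n ω)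
      (vHat n ω) (truncationLevel (lamHat n ω) (m n)) - Ψ‖} ⊆
      {ω | δ ≤ ‖empiricalCross X X n ω - C‖} ∪
        {ω | η / 3 ≤ m n * ‖empiricalCross X R n ω - 0‖} := by
    intro ω hω
    by_contra hnot
    simp only [Set.mem_union, Set.mem_ofPred_eq, not_or, not_le, sub_zero] at hnot hω
    rw [hdecomp] at hω
    have h1 := norm_pcEstimator_sub_le (hHat n ω) Ψ (empiricalCross X R n ω) hm0
    have h2 := hM _ _ _ (m n) (hHat n ω) (inner_empiricalCross_left X n ω)
      (inner_empiricalCross_self_nonneg X n ω) (tendsto_eigenvalue_empiricalCross (hHat n ω))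
      hnot.1.le hMn
    linarith [hnot.2]
  refine (measure_mono hsub).trans ((measure_union_le _ _).trans (add_le_add ?_ ?_))
  · exact measure_le_ofReal_div (hc₁ n hn).1 (fun ω => norm_nonneg _) hδ (hc₁ n hn).2
  · refine measure_le_ofReal_div ((hc₂ n hn).1.const_mul (m n))
      (fun ω => mul_nonneg hm0 (norm_nonneg _)) (by positivity) ?_
    rw [integral_const_mul]
    exact mul_le_mul_of_nonneg_left (hc₂ n hn).2 hm0
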